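/- For real $\alpha>0$ and $\beta\in\mathbb{R}$ let $E_{\alpha,\beta}$ be the two-parameter Mittag-Leffler function, i.e. the entire function $$E_{\alpha,\beta}(z)=\sum_{k=0}^{\infty}\frac{z^k}{\Gamma(\alpha k+\beta)},\qquad z\in\mathbb{C},$$ which is real-valued on the real axis. If $\alpha>2$ and $\beta>2\alpha-1$, then there exists a compact set $K\subset\mathbb{C}$ (which may depend on $\alpha$ and $\beta$) such that $$|E_{\alpha,\beta}(z)|\ \ge\ E_{\alpha,\beta}(\operatorname{Re} z)\qquad\text{for all } z\in\mathbb{C}\setminus K.$$ -/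

import Mathlib

/-- The two-parameter Mittag-Leffler function `E_{α,β}(z) = ∑_{k ≥ 0} z ^ k / Γ(α k + β)`, for a real
or complex variable `z`. Where `α k + β` is a pole of `Γ`, the term is `0`, which is the usual
convention `1 / Γ = 0` there. -/
noncomputable def mittagLeffler {𝕜 : Type*} [RCLike 𝕜] (α β : ℝ) (z : 𝕜) : 𝕜 :=
  ∑' k : ℕ, z ^ k / ((Real.Gamma (α * (k : ℝ) + β) : ℝ) : 𝕜)

/-- The defining series converges absolutely for all `z` when `α > 0`. -/
theorem summable_mittagLeffler {𝕜 : Type*} [RCLike 𝕜] {α : ℝ} (hα : 0 < α) (β : ℝ) (z : 𝕜) :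
    Summable (fun k : ℕ => z ^ k / ((Real.Gamma (α * (k : ℝ) + β) : ℝ) : 𝕜)) := by
  rcases eq_or_ne z 0 with rfl | hz
  · refine summable_of_ne_finset_zero (s := {0}) fun k hk => ?_
    have hk0 : k ≠ 0 := by simpa using hk
    simp [hk0]
  have hlin : Filter.Tendsto (fun k : ℕ => α * (k : ℝ) + β) Filter.atTop Filter.atTop :=
    Filter.tendsto_atTop_add_const_right _ _
      (tendsto_natCast_atTop_atTop.const_mul_atTop hα)
  have hpow : Filter.Tendsto (fun k : ℕ => (α * (k : ℝ) + β - 1) ^ α) Filter.atTop Filter.atTop :=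
    (tendsto_rpow_atTop hα).comp (Filter.tendsto_atTop_add_const_right _ (-1) hlin)
  -- log-convexity of `Γ` gives the growth of consecutive coefficients
  have key : ∀ x : ℝ, 1 < x → Real.Gamma x * (x - 1) ^ α ≤ Real.Gamma (x + α) := by
    intro x hx
    have h0 : 0 < x - 1 := by linarith
    have hG0 : 0 < Real.Gamma (x - 1) := Real.Gamma_pos_of_pos h0
    have hG1 : 0 < Real.Gamma x := Real.Gamma_pos_of_pos (by linarith)
    have hG2 : 0 < Real.Gamma (x + α) := Real.Gamma_pos_of_pos (by linarith)
    have hs := Real.convexOn_log_Gamma.slope_mono_adjacent (x := x - 1) (y := x) (z := x + α)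
      (Set.mem_Ioi.2 h0) (Set.mem_Ioi.2 (by linarith)) (by linarith) (by linarith)
    have hrec : Real.Gamma x = (x - 1) * Real.Gamma (x - 1) := by
      have := Real.Gamma_add_one h0.ne'
      simpa using this
    have hlog : Real.log (Real.Gamma x) = Real.log (x - 1) + Real.log (Real.Gamma (x - 1)) := by
      rw [hrec, Real.log_mul h0.ne' hG0.ne']
    simp only [Function.comp] at hs
    rw [show x - (x - 1) = 1 by ring, show x + α - x = α by ring, div_one, le_div_iff₀ hα] at hs
    rw [← Real.log_le_log_iff (by positivity) hG2, Real.log_mul hG1.ne' (by positivity),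
      Real.log_rpow h0]
    nlinarith
  refine summable_of_ratio_norm_eventually_le (r := 1 / 2) (by norm_num) ?_
  filter_upwards [hlin.eventually_gt_atTop 1, hpow.eventually_ge_atTop (2 * ‖z‖)] with k hk hk2
  set x : ℝ := α * (k : ℝ) + β with hx
  have hx1 : α * ((k + 1 : ℕ) : ℝ) + β = x + α := by rw [hx]; push_cast; ring
  have hG1 : 0 < Real.Gamma x := Real.Gamma_pos_of_pos (by linarith)
  have hG2 : 0 < Real.Gamma (x + α) := Real.Gamma_pos_of_pos (by linarith)
  rw [hx1, norm_div, norm_div, norm_pow, norm_pow, RCLike.norm_ofReal, RCLike.norm_ofReal,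
    abs_of_pos hG1, abs_of_pos hG2, div_le_iff₀ hG2]
  have h1 : Real.Gamma x * (2 * ‖z‖) ≤ Real.Gamma (x + α) :=
    le_trans (mul_le_mul_of_nonneg_left hk2 hG1.le) (key x hk)
  have h2 : 0 ≤ 1 / 2 * (‖z‖ ^ k / Real.Gamma x) := by positivity
  calc ‖z‖ ^ (k + 1) = 1 / 2 * (‖z‖ ^ k / Real.Gamma x) * (Real.Gamma x * (2 * ‖z‖)) := by
        field_simp
        ring
    _ ≤ _ := mul_le_mul_of_nonneg_left h1 h2

/-- On the real axis the complex function agrees with the real one. -/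
theorem mittagLeffler_ofReal (α β x : ℝ) :
    mittagLeffler α β (x : ℂ) = ((mittagLeffler α β x : ℝ) : ℂ) := by
  simp [mittagLeffler, Complex.ofReal_tsum]

/-! The function `E` has order 1/α < 1, so it is determined up to a constant by its zeros: `E` is a
limit of products of factors 1 - z/u. If all zeros were real, each factor would only shrink when z
is replaced by Re z, and the inequality would hold everywhere. A nonreal zero u still gives |Re z -
u|² ≤ |z - u| |conj z - u| once |z| ≥ 3|u|. Taking products and using |E(conj z)| = |E(z)| gives the
claim outside a disk, provided that only finitely many zeros are nonreal
(`finite_nonreal_zeros_mittagLeffler`). The product argument is `sq_norm_le_of_forall_zero`; it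
extracts finitely many zeros at a time and never forms the infinite product.

Finiteness comes from counting zeros with Jensen's formula. Shifting the inverse Laplace integral of
p^(α-β)/(p^α+1) past the poles exp(±iπ/α) shows that t^(β-1) E(-t^α) is a growing cosine wave plus a
smaller exponential (`exists_mittagLefflerProfile_asymptotic`). Its sign changes supply real zeros
of known density. Phragmén–Lindelöf turns the growth on the two half-axes into |E(re^(iθ))| ≤ C
exp(r^(1/α) cos(θ/α)), which bounds the circle means of log|E| from above. At the radius R = (πn /
sin(π/α))^α this bound is αn + O(1), while the real zeros alone already contribute αn - O(log n) to
the Jensen sum. Each nonreal zero adds α log n + O(1), so there is room for only finitely many. -/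

open Complex Metric Filter Topology MeasureTheory Set

/-! ### Entire functions of order less than one: comparison through zeros -/

/-- Reality of the zero `u`, or `z` being far from it, makes the product of the distances from `u`
to `z` and `conj z` at least the square of the distance to `Re z`. -/
theorem sq_norm_re_sub_le {u z : ℂ} (h : u.im = 0 ∨ 3 * ‖u‖ ≤ ‖z‖) :
    ‖(z.re : ℂ) - u‖ ^ 2 ≤ ‖z - u‖ * ‖(starRingEnd ℂ) z - u‖ := by
  refine le_of_sq_le_sq ?_ (by positivity)
  rw [mul_pow, ← pow_mul, show 2 * 2 = 2 * 2 from rfl, pow_mul]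
  simp only [Complex.sq_norm, Complex.normSq_apply, sub_re, sub_im, ofReal_re, ofReal_im, conj_re,
    conj_im]
  obtain ⟨x, y⟩ := z
  obtain ⟨a, b⟩ := u
  simp only at h ⊢
  -- This is the difference of the squared sides. If |z| ≥ 3|u|, then |z - a| ≥ 2|u|, so the bracket
  -- is nonnegative.
  have key : 0 ≤ y ^ 2 * (y ^ 2 + 2 * (x - a) ^ 2 - 2 * b ^ 2) := by
    refine mul_nonneg (sq_nonneg _) ?_
    rcases h with rfl | h
    · nlinarith [sq_nonneg y, sq_nonneg (x - a)]
    · have h2 : 9 * (a ^ 2 + b ^ 2) ≤ x ^ 2 + y ^ 2 := by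
        have := pow_le_pow_left₀ (by positivity) h 2
        simp only [mul_pow, Complex.sq_norm, Complex.normSq_apply] at this
        nlinarith
      nlinarith [sq_nonneg (x - 2 * a), sq_nonneg (x-3*a), sq_nonneg y, sq_nonneg b, sq_nonneg a]
  nlinarith [key]

/-- A zero-free g on a disk is g(0) exp h with h(0) = 0 and Re h ≤ log(M/|g(0)|), so
Borel–Carathéodory makes h of size log(M/|g(0)|) |z|/R on the half disk. When log M = o(R), such a
factor is asymptotically constant at fixed points. -/
theorem norm_le_norm_mul_exp_of_ne_zero {g : ℂ → ℂ} {R M : ℝ} (hR : 0 < R)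
    (hg : Differentiable ℂ g) (h0 : ∀ z ∈ ball (0 : ℂ) R, g z ≠ 0)
    (hM : ∀ z ∈ ball (0 : ℂ) R, ‖g z‖ ≤ M) {z w : ℂ} (hz : ‖z‖ ≤ R / 2) (hw : ‖w‖ ≤ R / 2) :
    ‖g w‖ ≤ ‖g z‖ * Real.exp (4 * (Real.log (M / ‖g 0‖) + 1) * (‖z‖ + ‖w‖) / R) := by
  have h00 : g 0 ≠ 0 := h0 0 (mem_ball_self hR)
  have hMpos : ‖g 0‖ ≤ M := hM 0 (mem_ball_self hR)
  have hg0 : 0 < ‖g 0‖ := norm_pos_iff.2 h00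
  -- The `+ 1` keeps the bound strictly positive when M = ‖g 0‖, as Borel–Carathéodory requires.
  have hL : 0 < Real.log (M / ‖g 0‖) + 1 := by
    have := Real.log_nonneg ((one_le_div hg0).2 hMpos)
    linarith
  have hld : DifferentiableOn ℂ (fun z => deriv g z / g z) (ball 0 R) :=
    hg.deriv.differentiableOn.div hg.differentiableOn h0
  obtain ⟨h, hh0, hh⟩ := hld.isExactOn_ball.with_val_at 0 0
  have hexp : ∀ z ∈ ball (0 : ℂ) R, g z = g 0 * exp (h z) := by
    have hc : ∀ z ∈ ball (0 : ℂ) R, HasDerivAt (fun z => g z * exp (-h z)) 0 z := by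
      intro z hz
      have := (hg z).hasDerivAt.mul ((hh z hz).neg.cexp)
      convert! this using 1
      field_simp [h0 z hz]
      ring
    intro z hz
    have := (convex_ball (0 : ℂ) R).is_const_of_fderivWithin_eq_zero (𝕜 := ℂ)
      (f := fun z => g z * exp (-h z))
      (fun z hz => (hc z hz).differentiableAt.differentiableWithinAt)
      (fun z hz => by
        rw [fderivWithin_of_isOpen isOpen_ball hz]
        ext
        simp [(hc z hz).deriv]) hz (mem_ball_self hR)
    simp only [hh0, neg_zero, exp_zero, mul_one] at this
    rw [← this, mul_assoc, ← exp_add]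
    simp
  have hre : ∀ z ∈ ball (0 : ℂ) R, (h z).re ≤ Real.log (M / ‖g 0‖) + 1 := by
    intro z hz
    have h1 := hM z hz
    rw [hexp z hz, norm_mul, norm_exp] at h1
    have : Real.exp (h z).re ≤ M / ‖g 0‖ := by rw [le_div_iff₀ hg0]; linarith
    have := (Real.le_log_iff_exp_le ((Real.exp_pos _).trans_le this)).2 this
    linarith
  have hb : ∀ z : ℂ, ‖z‖ ≤ R / 2 → ‖h z‖ ≤ 4 * (Real.log (M / ‖g 0‖) + 1) * ‖z‖ / R := by
    intro z hz
    have hzR : z ∈ ball (0 : ℂ) R := by simp; linarith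
    have := borelCaratheodory_zero hL
      (fun z hz => (hh z hz).differentiableAt.differentiableWithinAt) hre hR hzR hh0
    refine this.trans ?_
    rw [div_le_div_iff₀ (by linarith) hR]
    have : 0 ≤ 2 * (Real.log (M / ‖g 0‖) + 1) * ‖z‖ := by positivity
    nlinarith
  have hzR : z ∈ ball (0 : ℂ) R := by simp; linarith
  have hwR : w ∈ ball (0 : ℂ) R := by simp; linarith
  rw [hexp z hzR, hexp w hwR, norm_mul, norm_mul, norm_exp, norm_exp, mul_assoc, ← Real.exp_add]
  refine mul_le_mul_of_nonneg_left (Real.exp_le_exp.2 ?_) hg0.le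
  have h1 := (abs_le.1 (abs_re_le_norm (h z))).1
  have h2 := (abs_le.1 (abs_re_le_norm (h w))).2
  have := hb z hz
  have := hb w hw
  have e : 4 * (Real.log (M / ‖g 0‖) + 1) * (‖z‖ + ‖w‖) / R =
    4 * (Real.log (M / ‖g 0‖) + 1) * ‖z‖ / R + 4 * (Real.log (M / ‖g 0‖) + 1) * ‖w‖ / R := by ring
  linarith

/-- An entire function is a polynomial times an entire function without zeros in a given disk. -/
theorem exists_eq_prod_mul_of_entire {f : ℂ → ℂ} (hf : Differentiable ℂ f) (h0 : f 0 ≠ 0) {R M : ℝ}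
    (hR : 0 < R) (hM : ∀ z ∈ sphere (0 : ℂ) (3 * R), ‖f z‖ ≤ M) :
    ∃ (s : Multiset ℂ) (g : ℂ → ℂ), Differentiable ℂ g ∧ (∀ u ∈ s, f u = 0) ∧
      (∀ z, f z = (s.map fun u => 1 - z / u).prod * g z) ∧ (∀ z ∈ ball (0 : ℂ) R, g z ≠ 0) ∧
      ∀ z ∈ ball (0 : ℂ) R, ‖g z‖ ≤ M := by
  let P : Multiset ℂ → (ℂ → ℂ) → Prop := fun s g => Differentiable ℂ g ∧
    (∀ u ∈ s, f u = 0 ∧ ‖u‖ ≤ R) ∧ (∀ z, f z = (s.map fun u => 1 - z / u).prod * g z)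
  have hnz : ∀ u, f u = 0 → u ≠ 0 := fun u hu h => h0 (h ▸ hu)
  -- On |z| = 3R each factor 1 - z/u with |u| ≤ R has modulus at least 2, so every extracted zero
  -- halves the bound on the cofactor. At 0 this limits the number of zeros, so a maximal choice of
  -- s exists, and its cofactor has no zero left in the disk.
  have hbound : ∀ s g, P s g → ∀ z ∈ closedBall (0 : ℂ) (3 * R),
      ‖g z‖ ≤ M / 2 ^ (Multiset.card s) := by
    rintro s g ⟨hg, hs, hfg⟩
    have hsph : ∀ z ∈ sphere (0 : ℂ) (3 * R), ‖g z‖ ≤ M / 2 ^ (Multiset.card s) := by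
      intro z hz
      have h2 : (2 : ℝ) ^ (Multiset.card s) ≤ ‖(s.map fun u => 1 - z / u).prod‖ := by
        clear hfg
        induction s using Multiset.induction_on with
        | empty => simp
        | cons u s ih =>
          rw [Multiset.map_cons, Multiset.prod_cons, Multiset.card_cons, pow_succ', norm_mul]
          have hu := hs u (Multiset.mem_cons_self u s)
          have hu0 : 0 < ‖u‖ := norm_pos_iff.2 (hnz u hu.1)
          have h3 : 3 ≤ ‖z / u‖ := by
            rw [norm_div, le_div_iff₀ hu0, mem_sphere_zero_iff_norm.1 hz]
            nlinarith [hu.2]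
          have h4 := norm_sub_norm_le (z / u) 1
          rw [norm_sub_rev, norm_one] at h4
          gcongr
          · linarith
          · exact ih fun v hv => hs v (Multiset.mem_cons_of_mem hv)
      have h5 := hM z hz
      rw [hfg z, norm_mul] at h5
      rw [le_div_iff₀ (by positivity)]
      nlinarith [norm_nonneg (g z)]
    intro z hz
    refine Complex.norm_le_of_forall_mem_frontier_norm_le (U := ball (0 : ℂ) (3 * R))
      isBounded_ball hg.diffContOnCl ?_ ?_
    · rwa [frontier_ball _ (by positivity)]
    · rwa [closure_ball _ (by positivity)]
  have hval : ∀ s g, P s g → g 0 = f 0 := by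
    rintro s g ⟨-, -, hfg⟩
    simp [hfg 0]
  have hcard : ∀ s g, P s g → (2 : ℝ) ^ (Multiset.card s) ≤ M / ‖f 0‖ := by
    intro s g h
    have := hbound s g h 0 (mem_closedBall_self (by positivity))
    rw [hval s g h, le_div_iff₀ (by positivity)] at this
    rw [le_div_iff₀ (norm_pos_iff.2 h0)]
    linarith
  obtain ⟨N, hN⟩ := pow_unbounded_of_one_lt (M / ‖f 0‖) (one_lt_two (α := ℝ))
  have hcard' : ∀ s g, P s g → Multiset.card s ≤ N := by
    intro s g h
    by_contra! hlt
    have := hcard s g h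
    have := pow_le_pow_right₀ (one_le_two (α := ℝ)) hlt.le
    linarith
  classical
  have hex : ∃ n, ∃ s g, P s g ∧ Multiset.card s = n := ⟨0, 0, f, ⟨hf, by simp, by simp⟩, rfl⟩
  obtain ⟨n, ⟨s, g, hP, hsn⟩, hmax⟩ : ∃ n, (∃ s g, P s g ∧ Multiset.card s = n) ∧
      ∀ m, (∃ s g, P s g ∧ Multiset.card s = m) → m ≤ n := by
    have hb : ∀ m, (∃ s g, P s g ∧ Multiset.card s = m) → m ≤ N := by
      rintro m ⟨s, g, h, rfl⟩
      exact hcard' s g h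
    obtain ⟨n₀, hn₀⟩ := hex
    exact ⟨Nat.findGreatest (fun m => ∃ s g, P s g ∧ Multiset.card s = m) N,
      Nat.findGreatest_spec (P := fun m => ∃ s g, P s g ∧ Multiset.card s = m) (hb _ hn₀) hn₀,
      fun m hm => Nat.le_findGreatest (hb m hm) hm⟩
  refine ⟨s, g, hP.1, fun u hu => (hP.2.1 u hu).1, hP.2.2, ?_, ?_⟩
  · intro u hu hgu
    have hu' : ‖u‖ < R := by simpa using hu
    have hfu : f u = 0 := by rw [hP.2.2 u, hgu, mul_zero]
    have hu0 := hnz u hfu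
    -- The constant -u converts the factor z - u into 1 - z/u.
    have : P (u ::ₘ s) (fun z => -u * dslope g u z) := by
      refine ⟨?_, ?_, ?_⟩
      · refine Differentiable.const_mul ?_ _
        rw [← differentiableOn_univ] 
        exact (Complex.differentiableOn_dslope univ_mem).2 hP.1.differentiableOn
      · intro v hv
        rcases Multiset.mem_cons.1 hv with rfl | hv
        · exact ⟨hfu, hu'.le⟩
        · exact hP.2.1 v hv
      · intro z
        have : g z = (z - u) * dslope g u z := by
          have := sub_smul_dslope g u z
          rw [hgu, sub_zero, smul_eq_mul] at this
          exact this.symm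
        rw [hP.2.2 z, Multiset.map_cons, Multiset.prod_cons, this]
        field_simp
        ring
    have := hmax _ ⟨_, _, this, rfl⟩
    rw [Multiset.card_cons, hsn] at this
    omega
  · intro z hz
    have hz' : z ∈ closedBall (0 : ℂ) (3 * R) := by
      simp only [mem_ball, dist_zero_right, mem_closedBall] at hz ⊢
      linarith
    have hM0 : 0 ≤ M := by
      have h1 := hcard s g hP
      have h2 : 0 < M / ‖f 0‖ := lt_of_lt_of_le (by positivity) h1
      by_contra! h
      exact absurd h2 (not_lt.2 (div_nonpos_of_nonpos_of_nonneg h.le (norm_nonneg _)))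
    exact (hbound s g hP z hz').trans (div_le_self hM0 (one_le_pow₀ one_le_two))

/-- Comparison of the values of an entire function of order less than one at three points, from
the same comparison for the distances to its zeros. -/
theorem sq_norm_le_of_forall_zero {f : ℂ → ℂ} (hf : Differentiable ℂ f) (h0 : f 0 ≠ 0)
    {M : ℝ → ℝ} (hM1 : ∀ R, ‖f 0‖ ≤ M R) (hM : ∀ z, ‖f z‖ ≤ M ‖z‖)
    (hMo : Tendsto (fun R => Real.log (M (3 * R)) / R) atTop (𝓝 0)) {x z w : ℂ}
    (h : ∀ u, f u = 0 → ‖x - u‖ ^ 2 ≤ ‖z - u‖ * ‖w - u‖) : ‖f x‖ ^ 2 ≤ ‖f z‖ * ‖f w‖ := by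
  have hf0 : 0 < ‖f 0‖ := norm_pos_iff.2 h0
  set B : ℝ → ℝ := fun R => Real.log (M (3 * R) / ‖f 0‖) + 1 with hB
  -- For each R the extracted factors satisfy the inequality exactly, and the zero-free cofactor
  -- costs only an exponential error that tends to 1 as R grows.
  have hfin : ∀ᶠ R in atTop, ‖f x‖ ^ 2 ≤ ‖f z‖ * ‖f w‖ *
      Real.exp (4 * B R * (‖z‖ + ‖x‖) / R + 4 * B R * (‖w‖ + ‖x‖) / R) := by
    filter_upwards [eventually_gt_atTop 0, eventually_ge_atTop (2 * ‖x‖),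
      eventually_ge_atTop (2 * ‖z‖), eventually_ge_atTop (2 * ‖w‖)] with R hR hx hz hw
    obtain ⟨s, g, hg, hs, hfg, hg0, hgM⟩ := exists_eq_prod_mul_of_entire hf h0 hR
      (M := M (3 * R)) fun z hz => by
        have := hM z
        rwa [mem_sphere_zero_iff_norm.1 hz] at this
    have hg00 : g 0 = f 0 := by simp [hfg 0]
    have e1 := norm_le_norm_mul_exp_of_ne_zero hR hg hg0 hgM (z := z) (w := x)
      (by linarith) (by linarith)
    have e2 := norm_le_norm_mul_exp_of_ne_zero hR hg hg0 hgM (z := w) (w := x)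
      (by linarith) (by linarith)
    rw [hg00] at e1 e2
    have hp : ‖(s.map fun u => 1 - x / u).prod‖ ^ 2 ≤
        ‖(s.map fun u => 1 - z / u).prod‖ * ‖(s.map fun u => 1 - w / u).prod‖ := by
      clear hfg
      induction s using Multiset.induction_on with
      | empty => simp
      | cons u s ih =>
        have ih := ih fun v hv => hs v (Multiset.mem_cons_of_mem hv)
        have hu := hs u (Multiset.mem_cons_self u s)
        have hu0 : u ≠ 0 := fun h => h0 (h ▸ hu)
        have hu' : 0 < ‖u‖ := norm_pos_iff.2 hu0
        have hfac : ∀ v : ℂ, ‖1 - v / u‖ = ‖v - u‖ / ‖u‖ := by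
          intro v
          rw [← norm_div, ← norm_neg]
          congr 1
          field_simp
          ring
        have h1 : ‖1 - x / u‖ ^ 2 ≤ ‖1 - z / u‖ * ‖1 - w / u‖ := by
          rw [hfac, hfac, hfac, div_pow, div_mul_div_comm, ← sq]
          gcongr
          exact h u hu
        simp only [Multiset.map_cons, Multiset.prod_cons, norm_mul]
        rw [mul_pow]
        calc _ ≤ (‖1 - z / u‖ * ‖1 - w / u‖) * (‖(s.map fun u => 1 - z / u).prod‖ *
              ‖(s.map fun u => 1 - w / u).prod‖) := by gcongr
          _ = _ := by ring
    rw [hfg x, hfg z, hfg w, norm_mul, norm_mul, norm_mul, mul_pow, Real.exp_add]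
    calc _ ≤ (‖(s.map fun u => 1 - z / u).prod‖ * ‖(s.map fun u => 1 - w / u).prod‖) *
          ((‖g z‖ * Real.exp (4 * B R * (‖z‖ + ‖x‖) / R)) *
            (‖g w‖ * Real.exp (4 * B R * (‖w‖ + ‖x‖) / R))) := by
          rw [sq (‖g x‖)]
          gcongr
      _ = _ := by ring
  have hBo : Tendsto (fun R => B R / R) atTop (𝓝 0) := by
    have h1 : Tendsto (fun R : ℝ => Real.log (M (3 * R)) / R + (1 - Real.log ‖f 0‖) / R) atTop
        (𝓝 (0 + 0)) := hMo.add (tendsto_const_nhds.div_atTop tendsto_id)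
    rw [add_zero] at h1
    refine h1.congr fun R => ?_
    have : 0 < M (3 * R) := hf0.trans_le (hM1 _)
    rw [hB]
    simp only
    rw [Real.log_div this.ne' hf0.ne']
    ring
  have hlim : Tendsto (fun R => ‖f z‖ * ‖f w‖ *
      Real.exp (4 * B R * (‖z‖ + ‖x‖) / R + 4 * B R * (‖w‖ + ‖x‖) / R)) atTop
      (𝓝 (‖f z‖ * ‖f w‖ * Real.exp (0 * (4 * (‖z‖ + ‖x‖) + 4 * (‖w‖ + ‖x‖))))) := by
    refine Tendsto.const_mul _ ((Real.continuous_exp.tendsto _).comp ?_)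
    refine (hBo.mul_const _).congr fun R => ?_
    ring
  rw [zero_mul, Real.exp_zero, mul_one] at hlim
  exact ge_of_tendsto hlim hfin

/-! ### Laplace transforms and contour shifting -/

/-- The Laplace transform of an integrable function is holomorphic. -/
theorem differentiableOn_laplace {F : ℝ → ℂ} {c₀ : ℝ}
    (hF : ∀ c : ℝ, c₀ < c → IntegrableOn (fun t : ℝ => cexp (-(c * t)) * F t) (Ioi 0)) :
    DifferentiableOn ℂ (fun p : ℂ => ∫ t in Ioi (0 : ℝ), cexp (-(p * t)) * F t)
      {p | c₀ < p.re} := by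
  have hmeas : AEStronglyMeasurable F (volume.restrict (Ioi 0)) := by
    have h1 : AEStronglyMeasurable (fun t : ℝ => cexp (((c₀ + 1 : ℝ) : ℂ) * t))
        (volume.restrict (Ioi 0)) := by fun_prop
    refine (h1.mul (hF (c₀ + 1) (by linarith)).aestronglyMeasurable).congr ?_
    refine Eventually.of_forall fun t => ?_
    simp only [Pi.mul_apply]
    rw [← mul_assoc, ← Complex.exp_add]
    simp
  have hint : ∀ p : ℂ, c₀ < p.re →
      IntegrableOn (fun t : ℝ => cexp (-(p * t)) * F t) (Ioi 0) := by
    intro p hp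
    refine Integrable.mono (hF p.re hp) (by fun_prop) (Eventually.of_forall fun t => ?_)
    simp [Complex.norm_exp]
  intro p hp
  have hp' : c₀ < p.re := hp
  -- On the ball Re q ≥ c₀ + 2ε. One ε absorbs the factor t produced by differentiation, through t ≤
  -- e^(εt)/ε; the other keeps the dominating function integrable.
  set ε : ℝ := (p.re - c₀) / 3 with hε
  have hεpos : 0 < ε := by rw [hε]; linarith
  have hd := hasDerivAt_integral_of_dominated_loc_of_deriv_le
    (μ := volume.restrict (Ioi (0 : ℝ))) (F := fun (q : ℂ) (t : ℝ) => cexp (-(q * t)) * F t)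
    (F' := fun (q : ℂ) (t : ℝ) => cexp (-(q * t)) * (-(t : ℂ)) * F t) (x₀ := p) (s := ball p ε)
    (bound := fun t => (1 / ε) * ‖cexp (-(((c₀ + ε : ℝ) : ℂ) * t)) * F t‖)
    (ball_mem_nhds p hεpos) (Eventually.of_forall fun q => by fun_prop) (hint p hp') (by fun_prop)
    ?_ (((hF (c₀ + ε) (by linarith)).norm).const_mul _) ?_
  · exact hd.2.differentiableAt.differentiableWithinAt
  · refine (ae_restrict_mem measurableSet_Ioi).mono fun t (ht : 0 < t) q hq => ?_
    have hq' : c₀ + 2 * ε ≤ q.re := by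
      have h1 := abs_re_le_norm (q - p)
      rw [mem_ball, dist_eq_norm] at hq
      have h2 := (abs_le.1 (h1.trans hq.le)).1
      rw [sub_re] at h2
      have : 3 * ε = p.re - c₀ := by rw [hε]; ring
      linarith
    simp only [norm_mul, norm_neg, Complex.norm_exp, norm_real, Real.norm_eq_abs, abs_of_pos ht]
    rw [← mul_assoc]
    refine mul_le_mul_of_nonneg_right ?_ (norm_nonneg _)
    simp only [neg_re, mul_re, ofReal_re, ofReal_im, mul_zero, sub_zero]
    have h3 : t ≤ (1 / ε) * Real.exp (ε * t) := by
      have := Real.add_one_le_exp (ε * t)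
      rw [one_div, inv_mul_eq_div, le_div_iff₀ hεpos]
      linarith
    calc Real.exp (-(q.re * t)) * t
        ≤ Real.exp (-((c₀ + 2 * ε) * t)) * ((1 / ε) * Real.exp (ε * t)) := by gcongr
      _ = 1 / ε * Real.exp (-((c₀ + ε) * t)) := by
        rw [mul_left_comm, ← Real.exp_add]
        ring_nf
  · refine Eventually.of_forall fun t q _ => ?_
    refine HasDerivAt.mul_const ?_ _
    exact (((hasDerivAt_id q).mul_const (t : ℂ)).neg).cexp.congr_deriv (by simp)

theorem integrable_of_norm_le_inv_one_add_sq {g : ℝ → ℂ} (hg : Continuous g) {K : ℝ}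
    (hb : ∀ u, ‖g u‖ ≤ K / (1 + u ^ 2)) : Integrable g := by
  refine (integrable_inv_one_add_sq.const_mul K).mono' hg.aestronglyMeasurable
    (Eventually.of_forall fun u => ?_)
  simpa [div_eq_mul_inv] using hb u

/-- Shifting a vertical line of integration. -/
theorem integral_vertical_line_eq {G : ℂ → ℂ} {a b K : ℝ} (hab : a ≤ b)
    (hG : DifferentiableOn ℂ G (re ⁻¹' Icc a b))
    (hb : ∀ p : ℂ, a ≤ p.re → p.re ≤ b → ‖G p‖ ≤ K / (1 + p.im ^ 2)) :
    ∫ u : ℝ, G (b + u * I) = ∫ u : ℝ, G (a + u * I) := by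
  have hcont : ∀ x ∈ Icc a b, Continuous fun u : ℝ => G (x + u * I) := by
    intro x hx
    rw [← continuousOn_univ]
    refine hG.continuousOn.comp (by fun_prop) fun u _ => ?_
    simpa using hx
  have hint : ∀ x ∈ Icc a b, Integrable fun u : ℝ => G (x + u * I) := by
    intro x hx
    refine integrable_of_norm_le_inv_one_add_sq (K := K) (hcont x hx) fun u => ?_
    simpa using hb (x + u * I) (by simpa using hx.1) (by simpa using hx.2)
  have hlim : ∀ x ∈ Icc a b, Tendsto (fun T : ℝ => ∫ u in (-T)..T, G (x + u * I)) atTop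
      (𝓝 (∫ u : ℝ, G (x + u * I))) := fun x hx =>
    intervalIntegral_tendsto_integral (hint x hx) tendsto_neg_atTop_atBot tendsto_id
  have hhor : ∀ s : ℝ, (s = 1 ∨ s = -1) →
      Tendsto (fun T : ℝ => ∫ x in a..b, G (x + (s * T : ℝ) * I)) atTop (𝓝 0) := by
    intro s hs
    have hs2 : ∀ T : ℝ, (s * T) ^ 2 = T ^ 2 := by
      intro T
      rcases hs with rfl | rfl <;> ring
    refine squeeze_zero_norm (a := fun T => K / (1 + T ^ 2) * |b - a|) (fun T => ?_) ?_
    · refine intervalIntegral.norm_integral_le_of_norm_le_const fun x hx => ?_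
      rw [uIoc_of_le hab] at hx
      have := hb (x + (s * T : ℝ) * I) (by simpa using hx.1.le) (by simpa using hx.2)
      have him : ((x : ℂ) + (s * T : ℝ) * I).im = s * T := by simp
      rwa [him, hs2] at this
    · have : Tendsto (fun T : ℝ => K / (1 + T ^ 2)) atTop (𝓝 0) :=
        tendsto_const_nhds.div_atTop
          (tendsto_atTop_add_const_left _ _ (tendsto_pow_atTop two_ne_zero))
      simpa using this.mul_const |b - a|
  have hrect : ∀ T : ℝ, (∫ x in a..b, G (x + ((-1) * T : ℝ) * I)) -
      (∫ x in a..b, G (x + ((1 : ℝ) * T : ℝ) * I)) + I • (∫ u in (-T)..T, G (b + u * I)) -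
      I • (∫ u in (-T)..T, G (a + u * I)) = 0 := by
    intro T
    have := integral_boundary_rect_eq_zero_of_differentiableOn G (a + (-T : ℝ) * I) (b + T * I)
      (hG.mono fun p hp => by
        have := hp.1
        simp only [add_re, ofReal_re, mul_re, I_re, mul_zero, ofReal_im, I_im, mul_one,
          add_zero, sub_self, mem_preimage] at this
        rwa [uIcc_of_le hab] at this)
    simpa using this
  have hlim0 := (((hhor (-1) (Or.inr rfl)).sub (hhor 1 (Or.inl rfl))).add
    ((hlim b ⟨hab, le_rfl⟩).const_smul I)).sub ((hlim a ⟨le_rfl, hab⟩).const_smul I)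
  have h0 := tendsto_nhds_unique hlim0 ((tendsto_const_nhds (x := (0 : ℂ))).congr
    fun T => (hrect T).symm)
  rw [sub_zero, zero_add, ← smul_sub, smul_eq_zero, sub_eq_zero] at h0
  exact h0.resolve_left I_ne_zero

/-- Growth of a function whose Laplace transform extends to the left. -/
theorem norm_le_exp_of_laplace {D : ℝ → ℂ} {H : ℂ → ℂ} {a b K : ℝ} (hab : a ≤ b)
    (hDc : ContinuousOn D (Ici 0)) (hD0 : D 0 = 0)
    (hDi : IntegrableOn (fun t : ℝ => cexp (-(b * t)) * D t) (Ioi 0))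
    (hH : DifferentiableOn ℂ H (re ⁻¹' Icc a b))
    (hL : ∀ p : ℂ, p.re = b → ∫ t in Ioi (0 : ℝ), cexp (-(p * t)) * D t = H p)
    (hb : ∀ p : ℂ, a ≤ p.re → p.re ≤ b → ‖H p‖ ≤ K / (1 + p.im ^ 2)) {t : ℝ} (ht : 0 ≤ t) :
    ‖D t‖ ≤ K / 2 * Real.exp (a * t) := by
  -- The damped function extended by zero to t < 0; `D 0 = 0` makes the extension continuous. Its
  -- Fourier transform is H on the line Re p = b, so D is recovered by Fourier inversion and the
  -- line is then moved to Re p = a.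
  set φ : ℝ → ℂ := fun t => cexp (-(b * t)) * D (max t 0) with hφ
  have hφc : Continuous φ := by
    refine Continuous.mul (by fun_prop) ?_
    rw [← continuousOn_univ]
    exact hDc.comp (by fun_prop) fun t _ => le_max_right t 0
  have hφ0 : ∀ t, t ∉ Ioi (0 : ℝ) → φ t = 0 := by
    intro t ht
    simp only [mem_Ioi, not_lt] at ht
    simp [hφ, max_eq_right ht, hD0]
  have hφ1 : EqOn φ (fun t : ℝ => cexp (-(b * t)) * D t) (Ioi 0) := by
    intro t (ht : 0 < t)
    simp only [hφ, max_eq_left ht.le]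
  have hφi : Integrable φ := by
    rw [← integrableOn_iff_integrable_of_support_subset (s := Ioi (0 : ℝ))]
    · exact hDi.congr_fun hφ1.symm measurableSet_Ioi
    · intro t ht
      by_contra h
      exact ht (hφ0 t h)
  have hfou : ∀ ξ : ℝ, FourierTransform.fourier φ ξ = H (b + (2 * Real.pi * ξ : ℝ) * I) := by
    intro ξ
    rw [Real.fourier_real_eq_integral_exp_smul, ← hL _ (by simp),
      ← setIntegral_eq_integral_of_forall_compl_eq_zero (s := Ioi (0 : ℝ))
        (fun t ht => by rw [hφ0 t ht, smul_zero])]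
    refine setIntegral_congr_fun measurableSet_Ioi fun t ht => ?_
    rw [hφ1 ht]
    simp only [smul_eq_mul]
    rw [← mul_assoc, ← Complex.exp_add]
    congr 2
    push_cast
    ring
  have hcont : ∀ x ∈ Icc a b, Continuous fun u : ℝ => H (x + u * I) := by
    intro x hx
    rw [← continuousOn_univ]
    refine hH.continuousOn.comp (by fun_prop) fun u _ => ?_
    simpa using hx
  have hHi : Integrable fun u : ℝ => H (b + u * I) :=
    integrable_of_norm_le_inv_one_add_sq (K := K) (hcont b ⟨hab, le_rfl⟩) fun u => by
      simpa using hb (b + u * I) (by simpa using hab) (by simp)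
  have hfi : Integrable (FourierTransform.fourier φ) := by
    have := hHi.comp_mul_left' (R := 2 * Real.pi) (by positivity)
    refine this.congr (Eventually.of_forall fun ξ => ?_)
    rw [hfou]
  have hinv := hφi.fourierInv_fourier_eq hfi (hφc.continuousAt (x := t))
  have key : φ t = (2 * Real.pi : ℝ)⁻¹ • ∫ u : ℝ, cexp (u * t * I) * H (b + u * I) := by
    rw [← hinv, Real.fourierInv_eq']
    have := Measure.integral_comp_mul_left (fun u : ℝ => cexp (u * t * I) * H (b + u * I))
      (2 * Real.pi)
    rw [abs_of_pos (by positivity)] at this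
    rw [← this]
    refine integral_congr_ae (Eventually.of_forall fun ξ => ?_)
    simp only
    rw [hfou, smul_eq_mul]
    congr 2
    simp
    ring
  have hshift := integral_vertical_line_eq (G := fun p => cexp (p * t) * H p)
    (K := Real.exp (b * t) * K) hab (DifferentiableOn.mul (by fun_prop) hH) fun p hpa hpb => by
      rw [norm_mul, mul_div_assoc, Complex.norm_exp]
      refine mul_le_mul (Real.exp_le_exp.2 ?_) (hb p hpa hpb) (norm_nonneg _) (Real.exp_pos _).le
      simp only [mul_re, ofReal_re, ofReal_im, mul_zero, sub_zero]
      gcongr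
  have hDt : D t = (2 * Real.pi : ℝ)⁻¹ • ∫ u : ℝ, cexp ((b + u * I) * t) * H (b + u * I) := by
    have e : ∀ u : ℝ, cexp ((b + u * I) * t) * H (b + u * I) =
        cexp (b * t) * (cexp (u * t * I) * H (b + u * I)) := by
      intro u
      rw [← mul_assoc, ← Complex.exp_add]
      congr 2
      ring
    simp_rw [e]
    rw [integral_const_mul, ← mul_smul_comm, ← key, hφ]
    simp only [max_eq_left ht]
    rw [← mul_assoc, ← Complex.exp_add]
    simp
  rw [hDt, hshift, norm_smul, Real.norm_of_nonneg (by positivity)]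
  have hI : ‖∫ u : ℝ, cexp ((a + u * I) * t) * H (a + u * I)‖ ≤
      ∫ u : ℝ, Real.exp (a * t) * K * (1 + u ^ 2)⁻¹ := by
    refine norm_integral_le_of_norm_le (integrable_inv_one_add_sq.const_mul _)
      (Eventually.of_forall fun u => ?_)
    have := hb (a + u * I) (by simp) (by simpa using hab)
    have him : ((a : ℂ) + u * I).im = u := by simp
    rw [him, div_eq_mul_inv] at this
    rw [norm_mul, Complex.norm_exp, mul_assoc]
    simp only [mul_re, add_re, ofReal_re, I_re, mul_zero, ofReal_im, I_im, mul_one, sub_zero,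
      add_im, mul_im, add_zero, zero_add]
    gcongr
  rw [integral_const_mul, integral_univ_inv_one_add_sq] at hI
  calc _ ≤ (2 * Real.pi)⁻¹ * (Real.exp (a * t) * K * Real.pi) := by gcongr
    _ = _ := by field_simp

/-! ### Basic properties and growth of the Mittag-Leffler function -/

theorem mittagLeffler_differentiable {α : ℝ} (hα : 0 < α) (β : ℝ) :
    Differentiable ℂ (mittagLeffler α β : ℂ → ℂ) := by
  intro z
  have hs := (summable_mittagLeffler (𝕜 := ℝ) hα β (‖z‖ + 1)).norm
  have := differentiableOn_tsum_of_summable_norm (U := ball (0 : ℂ) (‖z‖ + 1)) hs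
    (F := fun (k : ℕ) (w : ℂ) => w ^ k / ((Real.Gamma (α * (k : ℝ) + β) : ℝ) : ℂ))
    (fun k => by fun_prop) isOpen_ball fun k w hw => by
      rw [mem_ball_zero_iff] at hw
      rw [norm_div, norm_div, norm_pow, norm_pow, norm_real, Real.norm_of_nonneg (by positivity :
        0 ≤ ‖z‖ + 1)]
      simp only [Real.norm_eq_abs, RCLike.ofReal_real_eq_id, id_eq]
      gcongr
  exact this.differentiableAt (isOpen_ball.mem_nhds (by simp))

theorem mittagLeffler_real_continuous {α : ℝ} (hα : 0 < α) (β : ℝ) :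
    Continuous (mittagLeffler α β : ℝ → ℝ) := by
  have : (mittagLeffler α β : ℝ → ℝ) = fun x : ℝ => (mittagLeffler α β ((x : ℝ) : ℂ)).re := by
    ext x
    rw [mittagLeffler_ofReal, ofReal_re]
  rw [this]
  exact continuous_re.comp ((mittagLeffler_differentiable hα β).continuous.comp continuous_ofReal)

theorem mittagLeffler_conj (α β : ℝ) (z : ℂ) :
    mittagLeffler α β ((starRingEnd ℂ) z) = (starRingEnd ℂ) (mittagLeffler α β z) := by
  simp [mittagLeffler, Complex.conj_tsum]

theorem Gamma_mul_nat_add_pos {α β : ℝ} (hα : 0 < α) (hβ : 0 < β) (k : ℕ) : 0 < Real.Gamma (α * k + β) :=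
  Real.Gamma_pos_of_pos (by positivity)

theorem norm_mittagLeffler_le {α β : ℝ} (hα : 0 < α) (hβ : 0 < β) {𝕜 : Type*} [RCLike 𝕜] (z : 𝕜) :
    ‖mittagLeffler α β z‖ ≤ mittagLeffler α β ‖z‖ := by
  have hG := Gamma_mul_nat_add_pos hα hβ
  refine tsum_of_norm_bounded (summable_mittagLeffler hα β ‖z‖).hasSum fun k => ?_
  rw [norm_div, norm_pow, RCLike.norm_ofReal, abs_of_pos (hG k)]
  simp

theorem mittagLeffler_le_of_le {α β : ℝ} (hα : 0 < α) (hβ : 0 < β) {x y : ℝ} (hx : 0 ≤ x) (hxy : x ≤ y) :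
    mittagLeffler α β x ≤ mittagLeffler α β y := by
  have hG := Gamma_mul_nat_add_pos hα hβ
  refine (summable_mittagLeffler hα β x).tsum_le_tsum (fun k => ?_) (summable_mittagLeffler hα β y)
  simp only [RCLike.ofReal_real_eq_id, id_eq]
  have := hG k
  gcongr

theorem mittagLeffler_zero_pos (α : ℝ) {β : ℝ} (hβ : 0 < β) : 0 < mittagLeffler α β (0 : ℝ) := by
  have : mittagLeffler α β (0 : ℝ) = 1 / Real.Gamma β := by
    rw [mittagLeffler, tsum_eq_single 0 fun k hk => by simp [hk]]
    simp
  rw [this]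
  have := Real.Gamma_pos_of_pos hβ
  positivity

theorem mittagLeffler_complex_zero_ne (α : ℝ) {β : ℝ} (hβ : 0 < β) :
    mittagLeffler α β (0 : ℂ) ≠ 0 := by
  have := mittagLeffler_ofReal α β 0
  rw [ofReal_zero] at this
  rw [this]
  exact_mod_cast (mittagLeffler_zero_pos α hβ).ne'

/-- On the positive axis, each term is dominated by a term of the exponential series. -/
theorem mittagLeffler_rpow_le {α β : ℝ} (hα : 1 ≤ α) (hβ : 3 ≤ β) {w : ℝ} (hw : 0 ≤ w) :
    mittagLeffler α β (w ^ α) ≤ Real.exp 1 * Real.exp w := by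
  have main : ∀ w : ℝ, 1 ≤ w → mittagLeffler α β (w ^ α) ≤ Real.exp w := by
    intro w hw
    have hw0 : 0 < w := by linarith
    -- With this exponent αk ≤ n k and (n k)! ≤ Γ(αk + β), so the k-th term is at most the (n k)-th
    -- exponential term when w ≥ 1. Distinct k use distinct terms because α ≥ 1.
    set n : ℕ → ℕ := fun k => ⌊α * k + β⌋₊ - 1 with hn
    have hfl : ∀ k : ℕ, 3 ≤ ⌊α * k + β⌋₊ := fun k =>
      Nat.le_floor (by push_cast; nlinarith [Nat.cast_nonneg (α := ℝ) k])
    have hinj : Function.Injective n := by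
      refine StrictMono.injective (strictMono_nat_of_lt_succ fun k => ?_)
      have h1 : ⌊α * k + β⌋₊ + 1 ≤ ⌊α * ((k + 1 : ℕ) : ℝ) + β⌋₊ := by
        refine Nat.le_floor ?_
        have := Nat.floor_le (a := α * k + β) (by nlinarith [Nat.cast_nonneg (α := ℝ) k])
        push_cast
        linarith
      have := hfl k
      simp only [hn]
      omega
    have hterm : ∀ k : ℕ, (w ^ α) ^ k / Real.Gamma (α * k + β) ≤
        w ^ n k / (n k).factorial := by
      intro k
      set s : ℝ := α * k + β with hs
      have hs3 : 3 ≤ ⌊s⌋₊ := hfl k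
      have hsn : (n k : ℝ) + 1 = (⌊s⌋₊ : ℝ) := by
        have : n k + 1 = ⌊s⌋₊ := by simp only [hn, ← hs]; omega
        exact_mod_cast this
      have hfs : (⌊s⌋₊ : ℝ) ≤ s := Nat.floor_le (by positivity)
      have hsf : s < ⌊s⌋₊ + 1 := Nat.lt_floor_add_one s
      have hs3' : (3 : ℝ) ≤ ⌊s⌋₊ := by exact_mod_cast hs3
      have hG : ((n k).factorial : ℝ) ≤ Real.Gamma s := by
        rw [← Real.Gamma_nat_eq_factorial, hsn]
        exact Real.Gamma_strictMonoOn_Ici.monotoneOn (by simp; linarith) (by simp; linarith) hfs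
      have hp : (w ^ α) ^ k ≤ w ^ n k := by
        rw [← Real.rpow_natCast, ← Real.rpow_mul hw0.le, ← Real.rpow_natCast]
        refine Real.rpow_le_rpow_of_exponent_le hw ?_
        linarith
      have : (0 : ℝ) < (n k).factorial := by positivity
      gcongr
    have hsum := Real.summable_pow_div_factorial w
    calc mittagLeffler α β (w ^ α) ≤ ∑' k : ℕ, w ^ k / k.factorial :=
          Summable.tsum_le_tsum_of_inj n hinj (fun k _ => by positivity) hterm
            (summable_mittagLeffler (by linarith) β (w ^ α)) hsum
      _ = Real.exp w := by rw [Real.exp_eq_exp_ℝ, NormedSpace.exp_eq_tsum_div]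
  rcases le_total 1 w with h | h
  · exact (main w h).trans (le_mul_of_one_le_left (Real.exp_pos _).le (Real.one_le_exp zero_le_one))
  · have h1 := main 1 le_rfl
    rw [Real.one_rpow] at h1
    calc mittagLeffler α β (w ^ α) ≤ mittagLeffler α β 1 :=
          mittagLeffler_le_of_le (by linarith) (by linarith) (by positivity)
            (Real.rpow_le_one hw h (by linarith))
      _ ≤ Real.exp 1 := h1
      _ ≤ _ := le_mul_of_one_le_right (Real.exp_pos _).le (Real.one_le_exp hw)

/-! ### Asymptotics on the negative axis -/

/-- Partial fractions for a quotient with two simple poles. -/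
theorem exists_partial_fractions {U : Set ℂ} (hU : IsOpen U) {a b : ℂ} (ha : a ∈ U) (hb : b ∈ U)
    (hab : a ≠ b) {n q : ℂ → ℂ} (hn : DifferentiableOn ℂ n U) (hq : DifferentiableOn ℂ q U)
    {qa qb : ℂ} (hqa : HasDerivAt q qa a) (hqb : HasDerivAt q qb b) (hqa0 : qa ≠ 0) (hqb0 : qb ≠ 0)
    (hza : q a = 0) (hzb : q b = 0) (hz : ∀ p ∈ U, q p = 0 → p = a ∨ p = b) :
    ∃ G : ℂ → ℂ, DifferentiableOn ℂ G U ∧ ∀ p ∈ U, p ≠ a → p ≠ b →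
      n p / q p = G p + n a / qa / (p - a) + n b / qb / (p - b) := by
  -- Both zeros are divided out, q = (p - a)(p - b) q₂. They are simple, so q₂ has no zero in U.
  set q₂ := dslope (dslope q a) b with hq₂
  have hq₂d : DifferentiableOn ℂ q₂ U :=
    (differentiableOn_dslope (hU.mem_nhds hb)).2 ((differentiableOn_dslope (hU.mem_nhds ha)).2 hq)
  have hqf : ∀ p, q p = (p - a) * ((p - b) * q₂ p) := by
    intro p
    have h1 := sub_smul_dslope q a p
    have h2 := sub_smul_dslope (dslope q a) b p
    have h3 : dslope q a b = 0 := by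
      rw [dslope_of_ne _ hab.symm, slope_def_field, hza, hzb]
      simp
    rw [hza, sub_zero, smul_eq_mul] at h1
    rw [h3, sub_zero, smul_eq_mul] at h2
    rw [hq₂, h2, h1]
  have hd₂ : ∀ p ∈ U, DifferentiableAt ℂ q₂ p := fun p hp => hq₂d.differentiableAt (hU.mem_nhds hp)
  have ea : qa = (a - b) * q₂ a := by
    have h : HasDerivAt q ((a - b) * q₂ a) a := by
      have hd : HasDerivAt (fun p => (p - b) * q₂ p) _ a :=
        ((hasDerivAt_id a).sub_const b).mul (hd₂ a ha).hasDerivAt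
      have := ((hasDerivAt_id a).sub_const a).mul hd
      rw [funext hqf]
      refine this.congr_deriv ?_
      simp
    exact hqa.unique h
  have eb : qb = (b - a) * q₂ b := by
    have h : HasDerivAt q ((b - a) * q₂ b) b := by
      have hd : HasDerivAt (fun p => (p - a) * q₂ p) _ b :=
        ((hasDerivAt_id b).sub_const a).mul (hd₂ b hb).hasDerivAt
      have := ((hasDerivAt_id b).sub_const b).mul hd
      have e : q = fun p => (p - b) * ((p - a) * q₂ p) := by
        ext p
        rw [hqf p]
        ring
      rw [e]
      refine this.congr_deriv ?_
      simp
    exact hqb.unique h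
  have hne : ∀ p ∈ U, q₂ p ≠ 0 := by
    intro p hp h
    rcases hz p hp (by rw [hqf p, h]; ring) with rfl | rfl
    · exact hqa0 (by rw [ea, h, mul_zero])
    · exact hqb0 (by rw [eb, h, mul_zero])
  set m : ℂ → ℂ := fun p => n p / q₂ p with hm
  have hmd : DifferentiableOn ℂ m U := hn.div hq₂d hne
  -- Since 1/((p-a)(p-b)) = (a-b)⁻¹ (1/(p-a) - 1/(p-b)), removing the values m(a) and m(b) leaves
  -- these difference quotients.
  refine ⟨fun p => (a - b)⁻¹ * (dslope m a p - dslope m b p),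
    (((differentiableOn_dslope (hU.mem_nhds ha)).2 hmd).sub
      ((differentiableOn_dslope (hU.mem_nhds hb)).2 hmd)).const_mul _, fun p hp hpa hpb => ?_⟩
  have hab' := sub_ne_zero.2 hab
  have hba' := sub_ne_zero.2 hab.symm
  have hpa' := sub_ne_zero.2 hpa
  have hpb' := sub_ne_zero.2 hpb
  have h0 := hne p hp
  have h1 := hne a ha
  have h2 := hne b hb
  simp only
  rw [dslope_of_ne _ hpa, dslope_of_ne _ hpb, slope_def_field, slope_def_field, ea, eb, hqf p]
  have ema : n a / ((a - b) * q₂ a) = m a / (a - b) := by rw [hm]; field_simp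
  have emb : n b / ((b - a) * q₂ b) = -(m b / (a - b)) := by
    rw [hm, ← neg_sub a b]; field_simp
  have emp : n p / ((p - a) * ((p - b) * q₂ p)) = m p / ((p - a) * (p - b)) := by
    rw [hm]; field_simp
  rw [ema, emb, emp]
  field_simp
  ring

/-- The function `t ↦ t ^ (β - 1) * E_{α,β}(-t ^ α)`, whose Laplace transform is
`p ^ (α - β) / (p ^ α + 1)`. -/
noncomputable def mittagLefflerProfile (α β t : ℝ) : ℝ :=
  t ^ (β - 1) * mittagLeffler α β (-t ^ α)

theorem continuous_mittagLefflerProfile {α β : ℝ} (hα : 0 < α) (hβ : 1 ≤ β) :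
    Continuous (mittagLefflerProfile α β) := by
  unfold mittagLefflerProfile
  have h1 : Continuous fun t : ℝ => t ^ (β - 1) :=
    Real.continuous_rpow_const (by linarith)
  have h2 : Continuous fun t : ℝ => t ^ α := Real.continuous_rpow_const hα.le
  exact h1.mul ((mittagLeffler_real_continuous hα β).comp h2.neg)

theorem mittagLefflerProfile_zero (α : ℝ) {β : ℝ} (hβ : 1 < β) :
    mittagLefflerProfile α β 0 = 0 := by
  rw [mittagLefflerProfile, Real.zero_rpow (by linarith), zero_mul]

theorem abs_mittagLefflerProfile_le {α β : ℝ} (hα : 1 ≤ α) (hβ : 3 ≤ β) {t : ℝ} (ht : 0 ≤ t) :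
    |mittagLefflerProfile α β t| ≤ t ^ (β - 1) * (Real.exp 1 * Real.exp t) := by
  rw [mittagLefflerProfile, abs_mul, abs_of_nonneg (Real.rpow_nonneg ht _)]
  have h := norm_mittagLeffler_le (by linarith : 0 < α) (by linarith : 0 < β) (-t ^ α)
  rw [norm_neg, Real.norm_of_nonneg (Real.rpow_nonneg ht α), Real.norm_eq_abs] at h
  gcongr
  exact h.trans (mittagLeffler_rpow_le hα hβ ht)

theorem integrableOn_exp_mul_mittagLefflerProfile {α β : ℝ} (hα : 1 ≤ α) (hβ : 3 ≤ β) {c : ℝ}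
    (hc : 1 < c) :
    IntegrableOn (fun t => Real.exp (-(c * t)) * mittagLefflerProfile α β t) (Ioi 0) := by
  have h1 : IntegrableOn (fun t : ℝ => t ^ (β - 1) * Real.exp (-(c - 1) * t)) (Ioi 0) := by
    have := integrableOn_rpow_mul_exp_neg_mul_rpow (p := 1) (s := β - 1) (b := c - 1)
      (by linarith) one_pos (by linarith)
    simpa using this
  have hcont := continuous_mittagLefflerProfile (by linarith : 0 < α) (by linarith : 1 ≤ β)
  refine Integrable.mono' (h1.const_mul (Real.exp 1))
    (by fun_prop) ((ae_restrict_mem measurableSet_Ioi).mono fun t (ht : 0 < t) => ?_)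
  rw [norm_mul, Real.norm_eq_abs, Real.abs_exp, Real.norm_eq_abs]
  calc _ ≤ Real.exp (-(c * t)) * (t ^ (β - 1) * (Real.exp 1 * Real.exp t)) := by
        gcongr
        exact abs_mittagLefflerProfile_le hα hβ ht.le
    _ = Real.exp 1 * (t ^ (β - 1) * (Real.exp (-(c * t)) * Real.exp t)) := by ring
    _ = _ := by rw [← Real.exp_add]; ring_nf

/-- Termwise integration: each Gamma integral cancels its coefficient and leaves a geometric series
of ratio -c^(-α), absolutely convergent for c > 1. -/
theorem integral_exp_mul_mittagLefflerProfile {α β : ℝ} (hα : 0 < α) (hβ : 0 < β) {c : ℝ}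
    (hc : 1 < c) :
    ∫ t in Ioi (0 : ℝ), Real.exp (-(c * t)) * mittagLefflerProfile α β t =
      c ^ (α - β) / (c ^ α + 1) := by
  have hc0 : 0 < c := by linarith
  have hpos : ∀ k : ℕ, 0 < α * k + β := fun k => by positivity
  have hΓ := Gamma_mul_nat_add_pos hα hβ
  set F : ℕ → ℝ → ℝ := fun k t =>
    t ^ (α * k + β - 1) * Real.exp (-(c * t)) * ((-1) ^ k / Real.Gamma (α * k + β)) with hF
  have hFint : ∀ k, IntegrableOn (F k) (Ioi 0) := by
    intro k
    have := integrableOn_rpow_mul_exp_neg_mul_rpow (p := 1) (s := α * k + β - 1) (b := c)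
      (by linarith [hpos k]) one_pos hc0
    simp only [Real.rpow_one, neg_mul] at this
    exact this.mul_const _
  have hint : ∀ k : ℕ, ∫ t in Ioi (0 : ℝ), t ^ (α * k + β - 1) * Real.exp (-(c * t)) =
      (1 / c) ^ (α * k + β) * Real.Gamma (α * k + β) := fun k =>
    Real.integral_rpow_mul_exp_neg_mul_Ioi (hpos k) hc0
  have hFval : ∀ k, ∫ t in Ioi (0 : ℝ), F k t = (-(1 / c) ^ α) ^ k * (1 / c) ^ β := by
    intro k
    simp only [hF]
    rw [integral_mul_const, hint, neg_pow ((1 / c) ^ α), ← Real.rpow_natCast ((1 / c) ^ α),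
      ← Real.rpow_mul (by positivity), Real.rpow_add (by positivity)]
    have := (hΓ k).ne'
    field_simp
  have hFnorm : ∀ k, ∫ t in Ioi (0 : ℝ), ‖F k t‖ = ((1 / c) ^ α) ^ k * (1 / c) ^ β := by
    intro k
    have : EqOn (fun t => ‖F k t‖) (fun t => t ^ (α * k + β - 1) * Real.exp (-(c * t)) *
        (1 / Real.Gamma (α * k + β))) (Ioi 0) := by
      intro t (ht : 0 < t)
      simp only [hF, norm_mul, norm_div, norm_pow, norm_neg, norm_one, one_pow]
      rw [Real.norm_of_nonneg (by positivity), Real.norm_of_nonneg (by positivity),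
        Real.norm_of_nonneg (hΓ k).le]
    rw [setIntegral_congr_fun measurableSet_Ioi this, integral_mul_const, hint,
      ← Real.rpow_natCast ((1 / c) ^ α), ← Real.rpow_mul (by positivity),
      Real.rpow_add (by positivity)]
    have := (hΓ k).ne'
    field_simp
  have hr : (1 / c) ^ α < 1 :=
    Real.rpow_lt_one (by positivity) (by rw [div_lt_one hc0]; exact hc) hα
  have hr0 : 0 < (1 / c) ^ α := by positivity
  have hsum := hasSum_integral_of_summable_integral_norm hFint (by
    simp_rw [hFnorm]
    exact (summable_geometric_of_lt_one hr0.le hr).mul_right _)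
  simp_rw [hFval] at hsum
  have hgeo := (hasSum_geometric_of_abs_lt_one (r := -(1 / c) ^ α)
    (by rwa [abs_neg, abs_of_pos hr0])).mul_right ((1 / c) ^ β)
  have heq := hsum.unique hgeo
  have hcongr : EqOn (fun t => Real.exp (-(c * t)) * mittagLefflerProfile α β t)
      (fun t => ∑' k, F k t) (Ioi 0) := by
    intro t (ht : 0 < t)
    simp only [mittagLefflerProfile, mittagLeffler, hF]
    rw [← tsum_mul_left, ← tsum_mul_left]
    refine tsum_congr fun k => ?_
    rw [neg_pow, ← Real.rpow_natCast (t ^ α), ← Real.rpow_mul ht.le,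
      show α * (k : ℝ) + β - 1 = α * k + (β - 1) by ring, Real.rpow_add ht]
    simp only [RCLike.ofReal_real_eq_id, id_eq]
    ring
  rw [setIntegral_congr_fun measurableSet_Ioi hcongr, heq, one_div, Real.inv_rpow hc0.le,
    Real.inv_rpow hc0.le, Real.rpow_sub hc0]
  have : 0 < c ^ α := by positivity
  have : 0 < c ^ β := by positivity
  have : 1 - -(c ^ α)⁻¹ = (c ^ α + 1) / c ^ α := by field_simp; ring
  rw [this]
  field_simp

theorem cpow_add_one_ne_zero {α : ℝ} (hα : 0 < α) {p : ℂ} (hp : 1 < ‖p‖) :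
    p ^ (α : ℂ) + 1 ≠ 0 := by
  intro h
  have hp0 : p ≠ 0 := by
    rintro rfl
    simp at hp
    linarith
  have h1 : ‖p ^ (α : ℂ)‖ = 1 := by
    rw [eq_neg_of_add_eq_zero_left h]
    simp
  rw [norm_cpow_real] at h1
  exact (Real.one_lt_rpow hp hα).ne' h1

/-- Both sides are holomorphic on Re p > 1 and agree at real points accumulating at 2, so the
identity theorem applies. -/
theorem laplace_mittagLefflerProfile {α β : ℝ} (hα : 1 ≤ α) (hβ : 3 ≤ β) {p : ℂ}
    (hp : 1 < p.re) :
    ∫ t in Ioi (0 : ℝ), cexp (-(p * t)) * (mittagLefflerProfile α β t : ℂ) =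
      p ^ ((α - β : ℝ) : ℂ) / (p ^ (α : ℂ) + 1) := by
  have hα0 : 0 < α := by linarith
  have hU : IsOpen {p : ℂ | 1 < p.re} := isOpen_lt continuous_const continuous_re
  have hslit : ∀ p ∈ {p : ℂ | 1 < p.re}, p ∈ slitPlane := fun p hp =>
    Or.inl (by linarith [show 1 < p.re from hp])
  have hF : ∀ c : ℝ, 1 < c → IntegrableOn (fun t : ℝ => cexp (-(c * t)) *
      (mittagLefflerProfile α β t : ℂ)) (Ioi 0) := by
    intro c hc
    have := (integrableOn_exp_mul_mittagLefflerProfile hα hβ hc).ofReal (𝕜 := ℂ)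
    refine this.congr (Eventually.of_forall fun t => ?_)
    simp
  have h1 := (differentiableOn_laplace hF).analyticOnNhd hU
  have h2 : DifferentiableOn ℂ (fun p : ℂ => p ^ ((α - β : ℝ) : ℂ) / (p ^ (α : ℂ) + 1))
      {p : ℂ | 1 < p.re} := by
    refine DifferentiableOn.div ?_ ?_ fun p hp => cpow_add_one_ne_zero hα0
      (lt_of_lt_of_le hp (re_le_norm p))
    · exact differentiableOn_id.cpow_const hslit
    · exact (differentiableOn_id.cpow_const hslit).add_const _
  refine h1.eqOn_of_preconnected_of_frequently_eq (h2.analyticOnNhd hU)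
    (convex_halfSpace_re_gt 1).isPreconnected (z₀ := 2) (by simp) ?_ hp
  have ht : Tendsto (fun x : ℝ => (x : ℂ)) (𝓝[>] 2) (𝓝[≠] 2) := by
    refine tendsto_nhdsWithin_iff.2 ⟨?_, ?_⟩
    · exact ((continuous_ofReal.tendsto 2).mono_left nhdsWithin_le_nhds)
    · filter_upwards [self_mem_nhdsWithin] with x hx
      have : x ≠ 2 := ne_of_gt hx
      simpa using (by exact_mod_cast this : (x : ℂ) ≠ 2)
  refine ht.frequently (Eventually.frequently ?_)
  filter_upwards [self_mem_nhdsWithin] with x hx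
  have hx1 : 1 < x := by linarith [show 2 < x from hx]
  have hx0 : 0 ≤ x := by linarith
  have := congrArg (fun r : ℝ => (r : ℂ))
    (integral_exp_mul_mittagLefflerProfile hα0 (by linarith : 0 < β) hx1)
  rw [← integral_complex_ofReal] at this
  push_cast [ofReal_cpow hx0] at this ⊢
  exact this

/-- The Laplace transform of `exp (a t) - 1`. -/
theorem laplace_exp_sub_one {a p : ℂ} (h : a.re < p.re) (hp : 0 < p.re) :
    IntegrableOn (fun t : ℝ => cexp (-(p * t)) * (cexp (a * t) - 1)) (Ioi 0) ∧
    ∫ t in Ioi (0 : ℝ), cexp (-(p * t)) * (cexp (a * t) - 1) = 1 / (p - a) - 1 / p := by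
  have e : ∀ t : ℝ, cexp (-(p * t)) * (cexp (a * t) - 1) =
      cexp ((a - p) * t) - cexp (-p * t) := by
    intro t
    rw [mul_sub, ← Complex.exp_add]
    ring_nf
  have h1 : (a - p).re < 0 := by simpa using h
  have h2 : (-p).re < 0 := by simpa using hp
  have i1 := integrableOn_exp_mul_complex_Ioi h1 0
  have i2 := integrableOn_exp_mul_complex_Ioi h2 0
  simp_rw [e]
  refine ⟨i1.sub i2, ?_⟩
  rw [integral_sub i1 i2, integral_exp_mul_complex_Ioi h1, integral_exp_mul_complex_Ioi h2]
  have hpa : p - a ≠ 0 := fun h0 => by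
    have := congrArg re h0
    simp at this
    linarith
  have hp0 : p ≠ 0 := fun h0 => by simp [h0] at hp
  rw [← neg_sub p a]
  simp only [ofReal_zero, mul_zero, Complex.exp_zero]
  field_simp

theorem exp_mul_I_cpow {θ : ℝ} (h1 : -Real.pi < θ) (h2 : θ ≤ Real.pi) (s : ℂ) :
    cexp (θ * I) ^ s = cexp (s * θ * I) := by
  rw [cpow_def_of_ne_zero (Complex.exp_ne_zero _), Complex.log_exp (by simpa using h1)
    (by simpa using h2)]
  ring_nf

/-- The roots of `p ^ α = -1` that are closest to the positive axis are `exp (± i π / α)`. -/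
theorem eq_or_eq_of_cpow_add_one_eq_zero {α : ℝ} (hα : 2 < α) {p : ℂ}
    (hp : Real.cos (min (2 * (Real.pi / α)) (Real.pi / 2)) < p.re)
    (h : p ^ (α : ℂ) + 1 = 0) :
    p = cexp ((Real.pi / α : ℝ) * I) ∨ p = cexp ((-(Real.pi / α) : ℝ) * I) := by
  have hπ := Real.pi_pos
  have hα0 : 0 < α := by linarith
  set m := min (2 * (Real.pi / α)) (Real.pi / 2) with hm
  have hm0 : 0 < m := lt_min (by positivity) (by positivity)
  have hm1 : m ≤ 2 * (Real.pi / α) := min_le_left _ _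
  have hm2 : m ≤ Real.pi / 2 := min_le_right _ _
  have hcm : 0 ≤ Real.cos m := Real.cos_nonneg_of_mem_Icc ⟨by linarith, hm2⟩
  have hp0 : p ≠ 0 := by
    rintro rfl
    simp only [zero_re] at hp
    linarith
  have hpα := eq_neg_of_add_eq_zero_left h
  have hnorm : ‖p‖ = 1 := by
    have h1 : ‖p ^ (α : ℂ)‖ = 1 := by rw [hpα]; simp
    rw [norm_cpow_real] at h1
    exact (Real.rpow_left_inj (norm_nonneg p) zero_le_one hα0.ne').1 (by rw [h1, Real.one_rpow])
  have hpe : p = cexp (arg p * I) := by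
    have := norm_mul_exp_arg_mul_I p
    rw [hnorm, ofReal_one, one_mul] at this
    exact this.symm
  have hre : p.re = Real.cos (arg p) := by
    rw [Complex.cos_arg hp0, hnorm, div_one]
  -- A root lies on the unit circle with α arg p an odd multiple of π. The half plane forces |arg p|
  -- < 2π/α, leaving only ±π.
  have harg : |arg p| < m := by
    by_contra! hle
    have h1 := Real.cos_le_cos_of_nonneg_of_le_pi hm0.le (abs_arg_le_pi p) hle
    rw [Real.cos_abs, ← hre] at h1
    linarith
  have hexp : cexp (α * arg p * I) = cexp (Real.pi * I) := by
    rw [Complex.exp_pi_mul_I, ← hpα]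
    conv_rhs => rw [hpe]
    rw [exp_mul_I_cpow (neg_pi_lt_arg p) (arg_le_pi p)]
  obtain ⟨n, hn⟩ := Complex.exp_eq_exp_iff_exists_int.1 hexp
  have hn' : α * arg p = Real.pi * (2 * n + 1) := by
    have := congrArg im hn
    simp at this
    linarith
  have hlt : |α * arg p| < 2 * Real.pi := by
    rw [abs_mul, abs_of_pos hα0]
    calc α * |arg p| < α * m := by gcongr
      _ ≤ α * (2 * (Real.pi / α)) := by gcongr
      _ = 2 * Real.pi := by field_simp
  rw [hn', abs_mul, abs_of_pos hπ, mul_comm] at hlt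
  have hlt2 := lt_of_mul_lt_mul_right hlt hπ.le
  rw [abs_lt] at hlt2
  have hn1 : n < 1 := by
    have : (n : ℝ) < 1 := by linarith
    exact_mod_cast this
  have hn2 : -2 < n := by
    have : (-2 : ℝ) < n := by linarith
    exact_mod_cast this
  have : n = 0 ∨ n = -1 := by omega
  rcases this with rfl | rfl
  · left
    have : arg p = Real.pi / α := by
      rw [eq_div_iff hα0.ne']
      push_cast at hn'
      linarith
    rw [← this]
    exact hpe
  · right
    have : arg p = -(Real.pi / α) := by
      rw [← neg_div, eq_div_iff hα0.ne']
      push_cast at hn'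
      linarith
    rw [← this]
    exact hpe

/-- For |p| ≥ 2 the denominator is at least |p|^α/2, so the quotient is O(|p|^(-β)). Quadratic decay
is what the contour shift needs. -/
theorem norm_cpow_div_le {α β : ℝ} (hα : 1 ≤ α) (hβ : 2 ≤ β) {p : ℂ} (hp : 2 ≤ ‖p‖) :
    ‖p ^ ((α - β : ℝ) : ℂ) / (p ^ (α : ℂ) + 1)‖ ≤ 2 / ‖p‖ ^ 2 := by
  have hp0 : 0 < ‖p‖ := by linarith
  have h1 : 2 ≤ ‖p‖ ^ α := by
    calc (2 : ℝ) ≤ ‖p‖ ^ (1 : ℝ) := by rwa [Real.rpow_one]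
      _ ≤ ‖p‖ ^ α := Real.rpow_le_rpow_of_exponent_le (by linarith) hα
  have h2 : ‖p‖ ^ α / 2 ≤ ‖p ^ (α : ℂ) + 1‖ := by
    have := norm_sub_le_norm_add (p ^ (α : ℂ)) 1
    rw [norm_cpow_real, norm_one] at this
    linarith
  have h3 : ‖p‖ ^ 2 ≤ ‖p‖ ^ β := by
    rw [← Real.rpow_two]
    exact Real.rpow_le_rpow_of_exponent_le (by linarith) hβ
  rw [norm_div, norm_cpow_real, Real.rpow_sub hp0]
  calc _ ≤ ‖p‖ ^ α / ‖p‖ ^ β / (‖p‖ ^ α / 2) := by gcongr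
    _ = 2 / ‖p‖ ^ β := by field_simp
    _ ≤ _ := by gcongr

/-- Decay on a vertical strip from decay at infinity. -/
theorem exists_bound_on_strip {H : ℂ → ℂ} {a b K : ℝ} (hH : ContinuousOn H (re ⁻¹' Icc a b))
    (hK : ∀ p : ℂ, a ≤ p.re → p.re ≤ b → 2 ≤ ‖p‖ → ‖H p‖ ≤ K / ‖p‖ ^ 2) :
    ∃ C, ∀ p : ℂ, a ≤ p.re → p.re ≤ b → ‖H p‖ ≤ C / (1 + p.im ^ 2) := by
  have hcomp : IsCompact (closedBall (0 : ℂ) 2 ∩ re ⁻¹' Icc a b) :=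
    (isCompact_closedBall _ _).inter_right (isClosed_Icc.preimage continuous_re)
  obtain ⟨C₁, hC₁⟩ := hcomp.exists_bound_of_continuousOn (hH.mono inter_subset_right)
  have him : ∀ p : ℂ, p.im ^ 2 ≤ ‖p‖ ^ 2 := fun p => by
    rw [← sq_abs]
    exact pow_le_pow_left₀ (abs_nonneg _) (abs_im_le_norm p) 2
  refine ⟨2 * |K| + 5 * |C₁|, fun p ha hb => ?_⟩
  rw [le_div_iff₀ (by positivity)]
  rcases le_total 2 ‖p‖ with h | h
  · have h1 := hK p ha hb h
    rw [le_div_iff₀ (by positivity)] at h1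
    have h2 : ‖H p‖ * (1 + p.im ^ 2) ≤ ‖H p‖ * (2 * ‖p‖ ^ 2) := by
      gcongr
      nlinarith [him p]
    nlinarith [le_abs_self K, abs_nonneg C₁]
  · have h1 := hC₁ p ⟨by simpa using h, ha, hb⟩
    have h2 : ‖H p‖ * (1 + p.im ^ 2) ≤ ‖H p‖ * 5 := by
      gcongr
      nlinarith [him p, norm_nonneg p]
    nlinarith [le_abs_self C₁, abs_nonneg K]

/-- The asymptotic behaviour of `E_{α,β}` on the negative axis. -/
theorem exists_mittagLefflerProfile_asymptotic {α β : ℝ} (hα : 2 < α) (hβ : 3 ≤ β) :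
    ∃ c K : ℝ, 0 < c ∧ c < Real.cos (Real.pi / α) ∧ ∀ t : ℝ, 0 ≤ t →
      |mittagLefflerProfile α β t - 2 / α * (Real.exp (t * Real.cos (Real.pi / α)) *
        Real.cos (t * Real.sin (Real.pi / α) + (1 - β) * (Real.pi / α)))| ≤ K * Real.exp (c * t) := by
  have hπ := Real.pi_pos
  have hα0 : 0 < α := by linarith
  set θ := Real.pi / α with hθ
  have hθ0 : 0 < θ := by positivity
  have hθ2 : θ < Real.pi / 2 := by rw [hθ]; gcongr
  -- The angle 2θ separates the roots at ±θ from all others, and the cap π/2 keeps the half plane Re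
  -- p > c₀ off the branch cut.
  set c₀ := Real.cos (min (2 * θ) (Real.pi / 2)) with hc₀
  have hc₀0 : 0 ≤ c₀ := Real.cos_nonneg_of_mem_Icc
    ⟨by linarith [lt_min (by positivity : 0 < 2 * θ) (by positivity : 0 < Real.pi / 2)],
      min_le_right _ _⟩
  have hc₀θ : c₀ < Real.cos θ := Real.cos_lt_cos_of_nonneg_of_le_pi hθ0.le
    ((min_le_right _ _).trans (by linarith)) (lt_min (by linarith) hθ2)
  obtain ⟨c, hc1, hc2⟩ := exists_between hc₀θ
  have hcle : c ≤ 2 := hc2.le.trans ((Real.cos_le_one θ).trans one_le_two)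
  set a := cexp (θ * I) with ha
  set b := cexp ((-θ : ℝ) * I) with hb
  have hare : a.re = Real.cos θ := by rw [ha, Complex.exp_ofReal_mul_I_re]
  have hbre : b.re = Real.cos θ := by rw [hb, Complex.exp_ofReal_mul_I_re, Real.cos_neg]
  have haim : a.im = Real.sin θ := by rw [ha, Complex.exp_ofReal_mul_I_im]
  have hbim : b.im = -Real.sin θ := by rw [hb, Complex.exp_ofReal_mul_I_im, Real.sin_neg]
  have hsin : 0 < Real.sin θ := Real.sin_pos_of_pos_of_lt_pi hθ0 (by linarith)
  have hab : a ≠ b := fun h => by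
    have := congrArg im h
    rw [haim, hbim] at this
    linarith
  have hna : ‖a‖ = 1 := Complex.norm_exp_ofReal_mul_I θ
  have hnb : ‖b‖ = 1 := Complex.norm_exp_ofReal_mul_I (-θ)
  have hpa : ∀ s : ℂ, a ^ s = cexp (s * θ * I) := fun s =>
    exp_mul_I_cpow (by linarith) (by linarith) s
  have hpb : ∀ s : ℂ, b ^ s = cexp (s * (-θ : ℝ) * I) := fun s =>
    exp_mul_I_cpow (by linarith) (by linarith) s
  set U : Set ℂ := {p | c₀ < p.re} with hU
  have hUo : IsOpen U := isOpen_lt continuous_const continuous_re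
  have hslit : ∀ p ∈ U, p ∈ slitPlane := fun p hp => Or.inl (lt_of_le_of_lt hc₀0 hp)
  have haU : a ∈ U := by rw [hU, mem_ofPred_eq, hare]; exact hc₀θ
  have hbU : b ∈ U := by rw [hU, mem_ofPred_eq, hbre]; exact hc₀θ
  have hαc : (α : ℂ) ≠ 0 := by exact_mod_cast hα0.ne'
  have hαθ : (α : ℂ) * θ = Real.pi := by
    rw [← ofReal_mul, hθ]
    congr 1
    field_simp
  have hqd : ∀ p ∈ U, HasDerivAt (fun p : ℂ => p ^ (α : ℂ) + 1) (α * p ^ ((α : ℂ) - 1)) p := by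
    intro p hp
    simpa using ((hasDerivAt_id p).cpow_const (c := (α : ℂ)) (hslit p hp)).add_const 1
  obtain ⟨G, hGd, hG⟩ := exists_partial_fractions hUo haU hbU hab
    (n := fun p => p ^ ((α - β : ℝ) : ℂ)) (q := fun p => p ^ (α : ℂ) + 1)
    (differentiableOn_id.cpow_const hslit) (fun p hp => (hqd p hp).differentiableAt.differentiableWithinAt)
    (hqd a haU) (hqd b hbU)
    (mul_ne_zero hαc (by rw [hpa]; exact Complex.exp_ne_zero _))
    (mul_ne_zero hαc (by rw [hpb]; exact Complex.exp_ne_zero _))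
    (by simp only [hpa, hαθ, Complex.exp_pi_mul_I]; ring)
    (by
      simp only [hpb, ofReal_neg, mul_neg, hαθ, neg_mul, Complex.exp_neg, Complex.exp_pi_mul_I]
      norm_num)
    (fun p hp h => eq_or_eq_of_cpow_add_one_eq_zero hα hp h)
  set A := a ^ ((α - β : ℝ) : ℂ) / (α * a ^ ((α : ℂ) - 1)) with hA
  set B := b ^ ((α - β : ℝ) : ℂ) / (α * b ^ ((α : ℂ) - 1)) with hB
  have hAe : A = cexp ((1 - β) * θ * I) / α := by
    rw [hA, hpa, hpa, div_mul_eq_div_div, div_div, mul_comm (α : ℂ), ← div_div, ← Complex.exp_sub]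
    congr 2
    push_cast
    ring
  have hBe : B = cexp ((1 - β) * (-θ : ℝ) * I) / α := by
    rw [hB, hpb, hpb, div_mul_eq_div_div, div_div, mul_comm (α : ℂ), ← div_div, ← Complex.exp_sub]
    congr 2
    push_cast
    ring
  -- Removing the poles alone would leave decay of order 1/p. The term (A + B)/p restores quadratic
  -- decay; in time it replaces e^(at) by e^(at) - 1, which also makes D vanish at 0. The resulting
  -- constant A + B is absorbed by e^(ct), as c > 0.
  set H : ℂ → ℂ := fun p => G p + (A + B) / p with hH
  have hne0 : ∀ p ∈ U, p ≠ 0 := fun p hp => slitPlane_ne_zero (hslit p hp)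
  have hHd : DifferentiableOn ℂ H U :=
    hGd.add (DifferentiableOn.div (by fun_prop) differentiableOn_id hne0)
  have hHeq : ∀ p ∈ U, p ≠ a → p ≠ b → H p = p ^ ((α - β : ℝ) : ℂ) / (p ^ (α : ℂ) + 1) -
      A * (1 / (p - a) - 1 / p) - B * (1 / (p - b) - 1 / p) := by
    intro p hp h1 h2
    have := hG p hp h1 h2
    rw [this, hH]
    simp only
    ring
  have hstrip : re ⁻¹' Icc c 2 ⊆ U := fun p hp => lt_of_lt_of_le hc1 hp.1
  have hfar : ∀ p : ℂ, c ≤ p.re → p.re ≤ 2 → 2 ≤ ‖p‖ →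
      ‖H p‖ ≤ (2 + 2 * ‖A‖ + 2 * ‖B‖) / ‖p‖ ^ 2 := by
    intro p h1 h2 h3
    have hp : p ∈ U := hstrip ⟨h1, h2⟩
    have hp0 := hne0 p hp
    have hpp : 0 < ‖p‖ := norm_pos_iff.2 hp0
    have aux : ∀ r : ℂ, ‖r‖ = 1 → p ≠ r ∧ ‖1 / (p - r) - 1 / p‖ ≤ 2 / ‖p‖ ^ 2 := by
      intro r hr
      have hpr : ‖p‖ / 2 ≤ ‖p - r‖ := by
        have := norm_sub_norm_le p r
        rw [hr] at this
        linarith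
      have hne : p - r ≠ 0 := norm_pos_iff.1 (by linarith)
      refine ⟨sub_ne_zero.1 hne, ?_⟩
      have e : 1 / (p - r) - 1 / p = r / ((p - r) * p) := by field_simp; ring
      rw [e, norm_div, norm_mul, hr]
      calc 1 / (‖p - r‖ * ‖p‖) ≤ 1 / (‖p‖ / 2 * ‖p‖) := by gcongr
        _ = _ := by field_simp
    obtain ⟨ha1, ha2⟩ := aux a hna
    obtain ⟨hb1, hb2⟩ := aux b hnb
    rw [hHeq p hp ha1 hb1]
    calc _ ≤ ‖p ^ ((α - β : ℝ) : ℂ) / (p ^ (α : ℂ) + 1)‖ + ‖A * (1 / (p - a) - 1 / p)‖ +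
          ‖B * (1 / (p - b) - 1 / p)‖ := (norm_sub_le _ _).trans (by gcongr; exact norm_sub_le _ _)
      _ ≤ 2 / ‖p‖ ^ 2 + ‖A‖ * (2 / ‖p‖ ^ 2) + ‖B‖ * (2 / ‖p‖ ^ 2) := by
        rw [norm_mul, norm_mul]
        gcongr
        exact norm_cpow_div_le (by linarith) (by linarith) h3
      _ = _ := by ring
  obtain ⟨K, hK⟩ := exists_bound_on_strip (hHd.continuousOn.mono hstrip) hfar
  set D : ℝ → ℂ := fun t => (mittagLefflerProfile α β t : ℂ) - A * (cexp (a * t) - 1) -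
    B * (cexp (b * t) - 1) with hD
  have hprofc := continuous_mittagLefflerProfile hα0 (by linarith : 1 ≤ β)
  have hDc : Continuous D := by
    have : Continuous fun t : ℝ => (mittagLefflerProfile α β t : ℂ) :=
      continuous_ofReal.comp hprofc
    rw [hD]
    fun_prop
  have hD0 : D 0 = 0 := by simp [hD, mittagLefflerProfile_zero α (by linarith : 1 < β)]
  have hsplit : ∀ p : ℂ, ∀ t : ℝ, cexp (-(p * t)) * D t =
      cexp (-(p * t)) * (mittagLefflerProfile α β t : ℂ) -
        A * (cexp (-(p * t)) * (cexp (a * t) - 1)) - B * (cexp (-(p * t)) * (cexp (b * t) - 1)) := by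
    intro p t
    simp only [hD]
    ring
  have hpint : ∀ p : ℂ, p.re = 2 →
      IntegrableOn (fun t : ℝ => cexp (-(p * t)) * (mittagLefflerProfile α β t : ℂ)) (Ioi 0) := by
    intro p hp
    have := integrableOn_exp_mul_mittagLefflerProfile (by linarith : 1 ≤ α) hβ one_lt_two
    have hm : Continuous fun t : ℝ => (mittagLefflerProfile α β t : ℂ) :=
      continuous_ofReal.comp hprofc
    refine Integrable.mono this (by fun_prop) (Eventually.of_forall fun t => ?_)
    simp [Complex.norm_exp, hp]
  have hcos1 : Real.cos θ < 2 := (Real.cos_le_one θ).trans_lt one_lt_two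
  have hla : ∀ p : ℂ, p.re = 2 → _ := fun p hp =>
    laplace_exp_sub_one (a := a) (p := p) (by rw [hare, hp]; exact hcos1) (by rw [hp]; norm_num)
  have hlb : ∀ p : ℂ, p.re = 2 → _ := fun p hp =>
    laplace_exp_sub_one (a := b) (p := p) (by rw [hbre, hp]; exact hcos1) (by rw [hp]; norm_num)
  have hDi : IntegrableOn (fun t : ℝ => cexp (-(((2 : ℝ) : ℂ) * t)) * D t) (Ioi 0) := by
    simp_rw [hsplit]
    exact ((hpint _ (by simp)).sub ((hla _ (by simp)).1.const_mul A)).sub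
      ((hlb _ (by simp)).1.const_mul B)
  have hL : ∀ p : ℂ, p.re = 2 → ∫ t in Ioi (0 : ℝ), cexp (-(p * t)) * D t = H p := by
    intro p hp
    have hpU : p ∈ U := hstrip (by simp [hp, hcle])
    simp_rw [hsplit]
    rw [integral_sub, integral_sub, integral_const_mul, integral_const_mul, (hla p hp).2,
      (hlb p hp).2, laplace_mittagLefflerProfile (by linarith) hβ (by rw [hp]; norm_num),
      hHeq p hpU]
    · rintro rfl
      linarith
    · rintro rfl
      linarith
    · exact hpint p hp
    · exact (hla p hp).1.const_mul A
    · exact (hpint p hp).sub ((hla p hp).1.const_mul A)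
    · exact (hlb p hp).1.const_mul B
  have hbound := fun t (ht : 0 ≤ t) => norm_le_exp_of_laplace hcle hDc.continuousOn hD0 hDi
    (hHd.mono hstrip) hL hK ht
  have hc0 : 0 < c := lt_of_le_of_lt hc₀0 hc1
  refine ⟨c, K / 2 + ‖A + B‖, hc0, hc2, fun t ht => ?_⟩
  have haE : a = Real.cos θ + Real.sin θ * I := by
    rw [ha, Complex.exp_mul_I, ofReal_cos, ofReal_sin]
  have hbE : b = Real.cos θ - Real.sin θ * I := by
    rw [hb, Complex.exp_mul_I, ← ofReal_cos, ← ofReal_sin, Real.cos_neg, Real.sin_neg]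
    push_cast
    ring
  have hmain : A * cexp (a * t) + B * cexp (b * t) = ((2 / α * (Real.exp (t * Real.cos θ) *
      Real.cos (t * Real.sin θ + (1 - β) * θ)) : ℝ) : ℂ) := by
    rw [hAe, hBe, div_mul_eq_mul_div, div_mul_eq_mul_div, ← Complex.exp_add, ← Complex.exp_add,
      haE, hbE]
    have e1 : (1 - β) * θ * I + (Real.cos θ + Real.sin θ * I) * t =
      ((t * Real.cos θ : ℝ) : ℂ) + ((t * Real.sin θ + (1 - β) * θ : ℝ) : ℂ) * I := by
      push_cast; ring
    have e2 : (1 - β) * (-θ : ℝ) * I + (Real.cos θ - Real.sin θ * I) * t =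
      ((t * Real.cos θ : ℝ) : ℂ) + -((t * Real.sin θ + (1 - β) * θ : ℝ) : ℂ) * I := by
      push_cast; ring
    rw [e1, e2, Complex.exp_add, Complex.exp_add]
    generalize t * Real.cos θ = r
    generalize t * Real.sin θ + (1 - β) * θ = s
    push_cast
    rw [Complex.cos]
    field_simp
  have hfin : ((mittagLefflerProfile α β t - 2 / α * (Real.exp (t * Real.cos θ) *
      Real.cos (t * Real.sin θ + (1 - β) * θ)) : ℝ) : ℂ) = D t - (A + B) := by
    rw [ofReal_sub, ← hmain, hD]
    ring
  rw [← Real.norm_eq_abs, ← norm_real, hfin]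
  calc _ ≤ ‖D t‖ + ‖A + B‖ := norm_sub_le _ _
    _ ≤ K / 2 * Real.exp (c * t) + ‖A + B‖ * Real.exp (c * t) := by
      gcongr
      · exact hbound t ht
      · exact le_mul_of_one_le_right (norm_nonneg _) (Real.one_le_exp (by positivity))
    _ = _ := by ring

/-! ### Growth in the plane and circle means -/

theorem exists_abs_mittagLeffler_neg_rpow_le {α β : ℝ} (hα : 2 < α) (hβ : 3 ≤ β) :
    ∃ C, 0 < C ∧ ∀ w : ℝ, 0 ≤ w →
      |mittagLeffler α β (-w ^ α)| ≤ C * Real.exp (w * Real.cos (Real.pi / α)) := by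
  obtain ⟨c, K, hc0, hc, h⟩ := exists_mittagLefflerProfile_asymptotic hα hβ
  have hcos : 0 < Real.cos (Real.pi / α) := hc0.trans hc
  have hα0 : 0 < α := by linarith
  refine ⟨2 / α + |K| + Real.exp 1 * Real.exp 1, by positivity, fun w hw => ?_⟩
  set e := Real.exp (w * Real.cos (Real.pi / α)) with he
  have he0 : 0 < e := Real.exp_pos _
  have he1 : 1 ≤ e := Real.one_le_exp (by positivity)
  rcases le_total 1 w with h1 | h1
  · have hp : 1 ≤ w ^ (β - 1) := Real.one_le_rpow h1 (by linarith)
    have h2 : |mittagLeffler α β (-w ^ α)| ≤ |mittagLefflerProfile α β w| := by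
      rw [mittagLefflerProfile, abs_mul, abs_of_nonneg (by linarith : 0 ≤ w ^ (β - 1))]
      exact le_mul_of_one_le_left (abs_nonneg _) hp
    have h3 := h w hw
    have h4 : |2 / α * (e *
        Real.cos (w * Real.sin (Real.pi / α) + (1 - β) * (Real.pi / α)))| ≤ 2 / α * e := by
      rw [abs_mul, abs_mul, abs_of_pos he0, abs_of_pos (by positivity : 0 < 2 / α)]
      have := Real.abs_cos_le_one (w * Real.sin (Real.pi / α) + (1 - β) * (Real.pi / α))
      gcongr
      exact mul_le_of_le_one_right he0.le this
    have h5 : K * Real.exp (c * w) ≤ |K| * e := by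
      have : Real.exp (c * w) ≤ e := by
        rw [he, mul_comm c w]
        gcongr
      exact mul_le_mul (le_abs_self K) this (Real.exp_pos _).le (abs_nonneg K)
    have h6 := abs_sub_abs_le_abs_sub (mittagLefflerProfile α β w) (2 / α * (e *
        Real.cos (w * Real.sin (Real.pi / α) + (1 - β) * (Real.pi / α))))
    have h7 : 0 < Real.exp 1 * Real.exp 1 * e := by positivity
    nlinarith
  · have h2 := norm_mittagLeffler_le hα0 (by linarith : 0 < β) (-w ^ α)
    rw [norm_neg, Real.norm_of_nonneg (Real.rpow_nonneg hw α), Real.norm_eq_abs] at h2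
    have h3 := mittagLeffler_rpow_le (by linarith : 1 ≤ α) hβ hw
    have h4 : Real.exp 1 * Real.exp w ≤ Real.exp 1 * Real.exp 1 := by gcongr
    have h5 : 0 ≤ (2 / α + |K|) * e := by positivity
    nlinarith [mul_pos (Real.exp_pos 1) (Real.exp_pos 1)]

/-- The Phragmén–Lindelöf bound for the Mittag-Leffler function in the upper half plane. -/
theorem exists_norm_mittagLeffler_le {α β : ℝ} (hα : 2 < α) (hβ : 3 ≤ β) :
    ∃ C, 0 < C ∧ ∀ r θ : ℝ, 0 < r → 0 ≤ θ → θ ≤ Real.pi →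
      ‖mittagLeffler α β ((r : ℂ) * cexp (θ * I))‖ ≤
        C * Real.exp (r ^ (1 / α) * Real.cos (θ / α)) := by
  have hα0 : 0 < α := by linarith
  have hπ := Real.pi_pos
  obtain ⟨C₁, hC₁, hneg⟩ := exists_abs_mittagLeffler_neg_rpow_le hα hβ
  set s : ℝ := 2 / α with hs
  have hs0 : 0 < s := by positivity
  have hs2 : s < 2 := by rw [hs, div_lt_iff₀ hα0]; linarith
  have hsα : s * α = 2 := by rw [hs]; field_simp
  set C := Real.exp 1 + C₁ with hC
  -- Squaring maps the first quadrant to the upper half plane. On both boundary rays Re ζ^s is the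
  -- known exponent of growth of E(ζ²), so f is bounded there; its order s < 2 is below the critical
  -- order of a quadrant.
  set f : ℂ → ℂ := fun ζ => mittagLeffler α β (ζ ^ 2) * cexp (-(ζ ^ (s : ℂ))) with hf
  have hnf : ∀ ζ, ‖f ζ‖ = ‖mittagLeffler α β (ζ ^ 2)‖ *
      Real.exp (-(‖ζ‖ ^ s * Real.cos (arg ζ * s))) := by
    intro ζ
    rw [hf]
    simp only [norm_mul, Complex.norm_exp, neg_re, Complex.cpow_ofReal_re]
  have hsq : ∀ x : ℝ, 0 ≤ x → (x ^ s) ^ α = x ^ 2 := by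
    intro x hx
    rw [← Real.rpow_mul hx, hsα, Real.rpow_two]
  have hE : ∀ ζ : ℂ, ‖mittagLeffler α β (ζ ^ 2)‖ ≤ Real.exp 1 * Real.exp (‖ζ‖ ^ s) := by
    intro ζ
    have h1 := norm_mittagLeffler_le hα0 (by linarith : 0 < β) (ζ ^ 2)
    rw [norm_pow, ← hsq _ (norm_nonneg ζ)] at h1
    exact h1.trans (mittagLeffler_rpow_le (by linarith) hβ (by positivity))
  have hEd := mittagLeffler_differentiable hα0 β
  have hd : DiffContOnCl ℂ f (Ioi 0 ×ℂ Ioi 0) := by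
    constructor
    · refine DifferentiableOn.mul ?_ ?_
      · exact (hEd.comp (differentiable_id.pow 2)).differentiableOn
      · refine (DifferentiableOn.neg (differentiableOn_id.cpow_const fun z hz => Or.inl hz.1)).cexp
    · rw [closure_reProdIm, closure_Ioi]
      refine ContinuousOn.mul ?_ ?_
      · exact (hEd.continuous.comp (continuous_pow 2)).continuousOn
      · refine (ContinuousOn.neg fun z hz => ?_).cexp
        exact (continuousAt_cpow_const_of_re_pos (Or.inl hz.1) (by simpa using hs0)).continuousWithinAt
  have hPL : ∀ ζ : ℂ, 0 ≤ ζ.re → 0 ≤ ζ.im → ‖f ζ‖ ≤ C := by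
    intro ζ h1 h2
    refine PhragmenLindelof.quadrant_I hd ⟨s, hs2, 2, ?_⟩ ?_ ?_ h1 h2
    · refine Asymptotics.IsBigO.of_bound (Real.exp 1) (Eventually.of_forall fun z => ?_)
      rw [hnf, Real.norm_of_nonneg (Real.exp_pos _).le]
      have h3 : Real.exp (-(‖z‖ ^ s * Real.cos (arg z * s))) ≤ Real.exp (‖z‖ ^ s) := by
        rw [Real.exp_le_exp]
        have h5 : 0 ≤ ‖z‖ ^ s := by positivity
        nlinarith [Real.neg_one_le_cos (arg z * s)]
      calc _ ≤ Real.exp 1 * Real.exp (‖z‖ ^ s) * Real.exp (‖z‖ ^ s) := by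
            gcongr
            exact hE z
        _ = _ := by rw [mul_assoc, ← Real.exp_add]; ring_nf
    · intro x hx
      rw [hnf, arg_ofReal_of_nonneg hx, zero_mul, Real.cos_zero, mul_one]
      have h3 := hE x
      rw [norm_real, Real.norm_of_nonneg hx] at *
      calc _ ≤ Real.exp 1 * Real.exp (x ^ s) * Real.exp (-(x ^ s)) := by gcongr
        _ = Real.exp 1 := by rw [mul_assoc, ← Real.exp_add]; simp
        _ ≤ C := by linarith
    · intro x hx
      rcases hx.eq_or_lt with rfl | hx'
      · have h3 := hE 0
        rw [hnf]
        simp only [ofReal_zero, zero_mul, norm_zero, Real.zero_rpow hs0.ne', neg_zero,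
          Real.exp_zero, mul_one] at h3 ⊢
        linarith
      rw [hnf, arg_real_mul I hx', arg_I, norm_mul, norm_I, mul_one, norm_real, Real.norm_of_nonneg hx]
      have e1 : ((x : ℂ) * I) ^ 2 = ((-(x ^ s) ^ α : ℝ) : ℂ) := by
        rw [hsq x hx, mul_pow, I_sq]
        push_cast
        ring
      rw [e1, mittagLeffler_ofReal, norm_real, Real.norm_eq_abs]
      have h3 := hneg (x ^ s) (by positivity)
      have e2 : Real.pi / 2 * s = Real.pi / α := by rw [hs]; field_simp
      rw [e2]
      calc _ ≤ C₁ * Real.exp (x ^ s * Real.cos (Real.pi / α)) *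
            Real.exp (-(x ^ s * Real.cos (Real.pi / α))) := by gcongr
        _ = C₁ := by rw [mul_assoc, ← Real.exp_add]; simp
        _ ≤ C := by linarith [Real.exp_pos 1]
  refine ⟨C, by positivity, fun r θ hr h0 h1 => ?_⟩
  set ζ : ℂ := (Real.sqrt r : ℂ) * cexp ((θ / 2 : ℝ) * I) with hζ
  have hsr : 0 < Real.sqrt r := Real.sqrt_pos.2 hr
  have hζ2 : ζ ^ 2 = (r : ℂ) * cexp (θ * I) := by
    rw [hζ, mul_pow, ← Complex.exp_nat_mul, ← ofReal_pow, Real.sq_sqrt hr.le]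
    congr 2
    push_cast
    ring
  have hζn : ‖ζ‖ = Real.sqrt r := by
    rw [hζ, norm_mul, Complex.norm_exp_ofReal_mul_I, norm_real, Real.norm_of_nonneg hsr.le, mul_one]
  have hζa : arg ζ = θ / 2 := by
    rw [hζ, Complex.exp_mul_I]
    exact_mod_cast Complex.arg_mul_cos_add_sin_mul_I hsr (θ := θ / 2) ⟨by linarith, by linarith⟩
  have hre : 0 ≤ ζ.re := by
    rw [hζ, re_ofReal_mul, Complex.exp_ofReal_mul_I_re]
    exact mul_nonneg hsr.le (Real.cos_nonneg_of_mem_Icc ⟨by linarith, by linarith⟩)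
  have him : 0 ≤ ζ.im := by
    rw [hζ, im_ofReal_mul, Complex.exp_ofReal_mul_I_im]
    exact mul_nonneg hsr.le (Real.sin_nonneg_of_nonneg_of_le_pi (by linarith) (by linarith))
  have h2 := hPL ζ hre him
  have e1 : Real.sqrt r ^ s = r ^ (1 / α) := by
    rw [Real.sqrt_eq_rpow, ← Real.rpow_mul hr.le, hs]
    congr 1
    field_simp
  have e2 : θ / 2 * s = θ / α := by rw [hs]; field_simp
  rw [hnf, hζ2, hζn, hζa, e1, e2, Real.exp_neg, ← div_eq_mul_inv, div_le_iff₀ (Real.exp_pos _)] at h2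
  exact h2

/-- The pointwise bound is integrated over the upper half circle, and conjugation symmetry gives the
lower half. The exact leading constant matters: it matches the density of the real zeros. -/
theorem circleAverage_log_norm_mittagLeffler_le {α β : ℝ} (hα : 2 < α) (hβ : 3 ≤ β) :
    ∃ C, ∀ R : ℝ, 0 < R → Real.circleAverage (fun z : ℂ => Real.log ‖mittagLeffler α β z‖) 0 R ≤
        C + R ^ (1 / α) * (α * Real.sin (Real.pi / α) / Real.pi) := by
  have hα0 : 0 < α := by linarith
  have hπ := Real.pi_pos
  obtain ⟨C, hC, hbound⟩ := exists_norm_mittagLeffler_le hα hβ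
  -- The maximum with 0 covers zeros on the circle, where `Real.log 0 = 0`.
  set L := max (Real.log C) 0 with hL
  refine ⟨L, fun R hR => ?_⟩
  set ρ := R ^ (1 / α) with hρ
  have hρ0 : 0 < ρ := by positivity
  have hcos : ∀ θ : ℝ, 0 ≤ θ → θ ≤ Real.pi → 0 ≤ Real.cos (θ / α) := by
    intro θ h0 h1
    refine Real.cos_nonneg_of_mem_Icc ⟨by linarith [div_nonneg h0 hα0.le], ?_⟩
    rw [div_le_div_iff₀ hα0 two_pos]
    nlinarith
  have hlog : ∀ θ : ℝ, 0 ≤ θ → θ ≤ Real.pi →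
      Real.log ‖mittagLeffler α β ((R : ℂ) * cexp (θ * I))‖ ≤ L + ρ * Real.cos (θ / α) := by
    intro θ h0 h1
    have hb := hbound R θ hR h0 h1
    have hc := hcos θ h0 h1
    rcases (norm_nonneg (mittagLeffler α β ((R : ℂ) * cexp (θ * I)))).eq_or_lt with h | h
    · rw [← h, Real.log_zero]
      have := le_max_right (Real.log C) 0
      positivity
    · have := Real.log_le_log h hb
      rw [Real.log_mul hC.ne' (Real.exp_pos _).ne', Real.log_exp] at this
      linarith [le_max_left (Real.log C) 0]
  have hint : ∀ a b : ℝ, a ∈ Icc 0 (2 * Real.pi) → b ∈ Icc 0 (2 * Real.pi) →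
      IntervalIntegrable (fun θ => Real.log ‖mittagLeffler α β (circleMap 0 R θ)‖) volume a b := by
    intro a b ha hb
    have hmer : MeromorphicOn (mittagLeffler α β : ℂ → ℂ) (sphere 0 |R|) := fun z _ =>
      ((mittagLeffler_differentiable hα0 β).analyticAt z).meromorphicAt
    have h1 : CircleIntegrable (fun z : ℂ => Real.log ‖mittagLeffler α β z‖) 0 R :=
      hmer.circleIntegrable_log_norm
    exact h1.mono_set (by rw [uIcc_of_le (by positivity : (0 : ℝ) ≤ 2 * Real.pi)]
                          exact ordConnected_Icc.uIcc_subset ha hb)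
  have hI1 : ∫ θ in (0 : ℝ)..Real.pi, Real.log ‖mittagLeffler α β (circleMap 0 R θ)‖ ≤
      ∫ θ in (0 : ℝ)..Real.pi, (L + ρ * Real.cos (θ / α)) := by
    refine intervalIntegral.integral_mono_on hπ.le (hint _ _ (by simp [hπ.le]) ⟨hπ.le, by linarith⟩)
      (Continuous.intervalIntegrable (by fun_prop) _ _) fun θ hθ => ?_
    have := hlog θ hθ.1 hθ.2
    simpa [circleMap] using this
  have hI2 : ∫ θ in Real.pi..(2 * Real.pi), Real.log ‖mittagLeffler α β (circleMap 0 R θ)‖ ≤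
      ∫ θ in Real.pi..(2 * Real.pi), (L + ρ * Real.cos ((2 * Real.pi - θ) / α)) := by
    refine intervalIntegral.integral_mono_on (by linarith)
      (hint _ _ ⟨hπ.le, by linarith⟩ ⟨by linarith, le_rfl⟩)
      (Continuous.intervalIntegrable (by fun_prop) _ _) fun θ hθ => ?_
    have := hlog (2 * Real.pi - θ) (by linarith [hθ.2]) (by linarith [hθ.1])
    have e : circleMap 0 R θ = (starRingEnd ℂ) ((R : ℂ) * cexp ((2 * Real.pi - θ : ℝ) * I)) := by
      rw [circleMap, zero_add, map_mul, conj_ofReal, ← Complex.exp_conj, map_mul, conj_ofReal,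
        conj_I]
      congr 1
      refine Complex.exp_eq_exp_iff_exists_int.2 ⟨1, ?_⟩
      push_cast
      ring
    rw [e, mittagLeffler_conj, RCLike.norm_conj]
    exact this
  have hval : ∫ θ in (0 : ℝ)..Real.pi, (L + ρ * Real.cos (θ / α)) =
      Real.pi * L + ρ * (α * Real.sin (Real.pi / α)) := by
    rw [intervalIntegral.integral_add (by simp) (Continuous.intervalIntegrable (by fun_prop) _ _),
      intervalIntegral.integral_const_mul, intervalIntegral.integral_comp_div _ hα0.ne']
    simp
  have hval2 : ∫ θ in Real.pi..(2 * Real.pi), (L + ρ * Real.cos ((2 * Real.pi - θ) / α)) =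
      Real.pi * L + ρ * (α * Real.sin (Real.pi / α)) := by
    rw [intervalIntegral.integral_comp_sub_left (fun θ => L + ρ * Real.cos (θ / α)), ← hval]
    congr 1 <;> ring
  rw [Real.circleAverage_def, ← intervalIntegral.integral_add_adjacent_intervals
    (hint 0 Real.pi (by simp [hπ.le]) ⟨hπ.le, by linarith⟩)
    (hint _ _ ⟨hπ.le, by linarith⟩ ⟨by linarith, le_rfl⟩), smul_eq_mul]
  calc _ ≤ (2 * Real.pi)⁻¹ * ((Real.pi * L + ρ * (α * Real.sin (Real.pi / α))) +
        (Real.pi * L + ρ * (α * Real.sin (Real.pi / α)))) := by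
        rw [hval] at hI1
        rw [hval2] at hI2
        gcongr
    _ = _ := by field_simp; ring

/-! ### Real zeros from sign changes -/

/-- The real zeros, with their asymptotic density. -/
theorem exists_real_zeros_mittagLeffler {α β : ℝ} (hα : 2 < α) (hβ : 3 ≤ β) :
    ∃ (m : ℕ) (r : ℕ → ℝ), StrictMono r ∧ ∀ j, 0 < r j ∧ mittagLeffler α β (-r j) = 0 ∧
      r j ≤ (Real.pi * ((j : ℝ) + m) / Real.sin (Real.pi / α)) ^ α := by
  have hα0 : 0 < α := by linarith
  have hπ := Real.pi_pos
  obtain ⟨c, K, hc0, hc, h⟩ := exists_mittagLefflerProfile_asymptotic hα hβ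
  set σ := Real.sin (Real.pi / α) with hσ
  set κ := Real.cos (Real.pi / α) with hκ
  set ψ := (1 - β) * (Real.pi / α) with hψ
  have hσ0 : 0 < σ := Real.sin_pos_of_pos_of_lt_pi (by positivity) (by
    rw [div_lt_iff₀ hα0]; nlinarith)
  -- At τ k the cosine in the asymptotic formula equals (-1)^k, so for large k the profile has the
  -- sign (-1)^k.
  set τ : ℕ → ℝ := fun k => (Real.pi * k - ψ) / σ with hτ
  have hτσ : ∀ k, τ k * σ + ψ = k * Real.pi := by
    intro k
    simp only [hτ]
    field_simp
    ring
  have hτmono : ∀ k, τ k < τ (k + 1) := by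
    intro k
    simp only [hτ]
    push_cast
    gcongr
    linarith
  have hτtop : Tendsto τ atTop atTop := by
    refine Tendsto.atTop_div_const hσ0 (tendsto_atTop_add_const_right _ _ ?_)
    exact tendsto_natCast_atTop_atTop.const_mul_atTop hπ
  have hdom : ∀ᶠ t : ℝ in atTop, K * Real.exp (c * t) < 2 / α * Real.exp (t * κ) := by
    have h1 : Tendsto (fun t : ℝ => 2 / α * Real.exp ((κ - c) * t)) atTop atTop :=
      (Real.tendsto_exp_atTop.comp (tendsto_id.const_mul_atTop (by linarith))).const_mul_atTop
        (by positivity)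
    filter_upwards [h1.eventually_gt_atTop K] with t ht
    have : Real.exp (t * κ) = Real.exp ((κ - c) * t) * Real.exp (c * t) := by
      rw [← Real.exp_add]; ring_nf
    rw [this, ← mul_assoc]
    exact mul_lt_mul_of_pos_right ht (Real.exp_pos _)
  obtain ⟨N, hN⟩ := eventually_atTop.1
    ((hτtop.eventually hdom).and (hτtop.eventually_gt_atTop 0))
  have hsign : ∀ k, N ≤ k → 0 < (-1) ^ k * mittagLefflerProfile α β (τ k) := by
    intro k hk
    obtain ⟨h1, h2⟩ := hN k hk
    have h3 := h (τ k) h2.le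
    rw [hτσ, Real.cos_nat_mul_pi] at h3
    have h4 : |(-1) ^ k * (mittagLefflerProfile α β (τ k) -
        2 / α * (Real.exp (τ k * κ) * (-1) ^ k))| ≤ K * Real.exp (c * τ k) := by
      rw [abs_mul]
      simpa using h3
    have h5 := (abs_le.1 h4).1
    have h6 : ((-1 : ℝ) ^ k) * (-1) ^ k = 1 := by rw [← mul_pow]; simp
    have h7 : (-1) ^ k * (mittagLefflerProfile α β (τ k) -
        2 / α * (Real.exp (τ k * κ) * (-1) ^ k)) =
        (-1) ^ k * mittagLefflerProfile α β (τ k) - 2 / α * Real.exp (τ k * κ) := by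
      linear_combination (-2 / α * Real.exp (τ k * κ)) * h6
    rw [h7] at h5
    linarith
  have hcont := continuous_mittagLefflerProfile hα0 (by linarith : 1 ≤ β)
  have hzero : ∀ k, N ≤ k → ∃ t ∈ Ioo (τ k) (τ (k + 1)), mittagLefflerProfile α β t = 0 := by
    intro k hk
    have h1 := hsign k hk
    have h2 := hsign (k + 1) (by omega)
    have hc' : ContinuousOn (fun t => (-1) ^ k * mittagLefflerProfile α β t)
        (Icc (τ k) (τ (k + 1))) := by fun_prop
    have h3 := intermediate_value_Ioo' (hτmono k).le hc'
    have h4 : (0 : ℝ) ∈ Ioo ((-1) ^ k * mittagLefflerProfile α β (τ (k + 1)))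
        ((-1) ^ k * mittagLefflerProfile α β (τ k)) := by
      refine ⟨?_, h1⟩
      rw [pow_succ] at h2
      linarith
    obtain ⟨t, ht, ht0⟩ := h3 h4
    refine ⟨t, ht, ?_⟩
    simpa using ht0
  choose! s hs hs0 using hzero
  have hspos : ∀ k, N ≤ k → 0 < s k := fun k hk => (hN k hk).2.trans (hs k hk).1
  obtain ⟨m₀, hm₀⟩ := exists_nat_ge (-ψ / Real.pi)
  -- The shift collects the starting index N, the right endpoint τ (k + 1) and m₀, which absorbs the
  -- phase ψ.
  refine ⟨N + 1 + m₀, fun j => s (N + j) ^ α, ?_, fun j => ⟨?_, ?_, ?_⟩⟩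
  · refine strictMono_nat_of_lt_succ fun j => ?_
    have h1 := (hs (N + j) (by omega)).2
    have h2 := (hs (N + j + 1) (by omega)).1
    exact Real.rpow_lt_rpow (hspos _ (by omega)).le (h1.trans h2) hα0
  · exact Real.rpow_pos_of_pos (hspos _ (by omega)) _
  · have h1 := hs0 (N + j) (by omega)
    rw [mittagLefflerProfile] at h1
    exact (mul_eq_zero.1 h1).resolve_left (Real.rpow_pos_of_pos (hspos _ (by omega)) _).ne'
  · have h1 := (hs (N + j) (by omega)).2.le
    refine Real.rpow_le_rpow (hspos _ (by omega)).le (h1.trans ?_) hα0.le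
    simp only [hτ]
    rw [div_le_iff₀ hπ] at hm₀
    push_cast
    gcongr
    linarith

/-! ### Jensen's formula and the count of nonreal zeros -/

/-- Jensen's inequality for a finite set of zeros. -/
theorem sum_log_div_norm_add_le_circleAverage {f : ℂ → ℂ} (hf : Differentiable ℂ f) (h0 : f 0 ≠ 0)
    {R : ℝ} (hR : 0 < R) (S : Finset ℂ) (hS : ∀ u ∈ S, f u = 0 ∧ ‖u‖ ≤ R) :
    ∑ u ∈ S, Real.log (R / ‖u‖) + Real.log ‖f 0‖ ≤
      Real.circleAverage (fun z => Real.log ‖f z‖) 0 R := by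
  classical
  have han : AnalyticOnNhd ℂ f (closedBall 0 |R|) := fun z _ => hf.analyticAt z
  rw [han.circleAverage_log_norm hR.ne' h0]
  gcongr
  set d := MeromorphicOn.divisor f (closedBall 0 |R|) with hd
  have hd0 : ∀ u, 0 ≤ d u := fun u => MeromorphicOn.AnalyticOnNhd.divisor_nonneg han u
  have hlog : ∀ u ∈ closedBall (0 : ℂ) |R|, 0 ≤ Real.log (R * ‖0 - u‖⁻¹) := by
    intro u hu
    rw [zero_sub, norm_neg]
    rcases (norm_nonneg u).eq_or_lt with h | h
    · simp [← h]
    · refine Real.log_nonneg ?_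
      rw [mem_closedBall_zero_iff, abs_of_pos hR] at hu
      rw [← div_eq_mul_inv, one_le_div h]
      exact hu
  have hfin : (Function.support fun u => (d u : ℝ) * Real.log (R * ‖0 - u‖⁻¹)).Finite := by
    refine (d.finiteSupport (isCompact_closedBall 0 |R|)).subset fun u hu => ?_
    simp only [Function.mem_support, ne_eq, mul_eq_zero, not_or, Int.cast_eq_zero] at hu ⊢
    exact hu.1
  rw [finsum_eq_sum_of_support_subset (s := hfin.toFinset ∪ S) _ (by
    intro u hu
    simp only [Finset.coe_union, Finite.coe_toFinset, Set.mem_union]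
    exact Or.inl hu)]
  -- Zeros in S have multiplicity at least one, and all discarded terms of Jensen's sum are
  -- nonnegative.
  refine le_trans (Finset.sum_le_sum fun u hu => ?_)
    (Finset.sum_le_sum_of_subset_of_nonneg Finset.subset_union_right fun u _ _ => ?_)
  · obtain ⟨hfu, huR⟩ := hS u hu
    have hmem : u ∈ closedBall (0 : ℂ) |R| := by
      rwa [mem_closedBall_zero_iff, abs_of_pos hR]
    have hd1 : 1 ≤ d u := by
      have hne : d u ≠ 0 := by
        rw [hd, MeromorphicOn.AnalyticOnNhd.divisor_apply han hmem]
        have h1 : analyticOrderAt f u ≠ 0 := by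
          rw [ne_eq, (hf.analyticAt u).analyticOrderAt_eq_zero]
          simpa using hfu
        have h2 : analyticOrderAt f u ≠ ⊤ := by
          rw [ne_eq, analyticOrderAt_eq_top]
          intro h
          have := AnalyticOnNhd.eq_of_eventuallyEq (f := f) (g := 0) (fun z _ => hf.analyticAt z)
            (fun z _ => analyticAt_const) h
          exact h0 (by rw [this]; rfl)
        obtain ⟨n, hn⟩ := ENat.ne_top_iff_exists.1 h2
        rw [← hn] at h1 ⊢
        simpa using h1
      have := hd0 u
      omega
    have h3 := hlog u hmem
    have e : R / ‖u‖ = R * ‖0 - u‖⁻¹ := by rw [zero_sub, norm_neg, div_eq_mul_inv]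
    rw [e]
    exact le_mul_of_one_le_left h3 (by exact_mod_cast hd1)
  · by_cases hu : u ∈ closedBall (0 : ℂ) |R|
    · exact mul_nonneg (by exact_mod_cast hd0 u) (hlog u hu)
    · rw [d.apply_eq_zero_of_notMem hu]
      simp

/-- A crude Stirling bound, from (n + 1) log((n + 1)/n) ≥ 1. Its logarithmic loss is compensated by
taking one more nonreal zero in the count. -/
theorem log_factorial_le {n : ℕ} (hn : 1 ≤ n) :
    Real.log n.factorial ≤ (n + 1) * Real.log n - n + 1 := by
  induction n, hn using Nat.le_induction with
  | base => simp
  | succ n hn ih =>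
    have hn0 : (0 : ℝ) < n := by exact_mod_cast hn
    have h1 := Real.one_sub_inv_le_log_of_pos (x := ((n : ℝ) + 1) / n) (by positivity)
    rw [Real.log_div (by positivity) hn0.ne', inv_div] at h1
    have h2 : 1 ≤ ((n : ℝ) + 1) * (Real.log (n + 1) - Real.log n) := by
      have : ((n : ℝ) + 1) * (1 - n / (n + 1)) = 1 := by field_simp; ring
      exact this.symm.le.trans (mul_le_mul_of_nonneg_left h1 (by positivity))
    rw [Nat.factorial_succ, Nat.cast_mul, Real.log_mul (Nat.cast_ne_zero.2 n.succ_ne_zero)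
      (Nat.cast_ne_zero.2 n.factorial_ne_zero)]
    push_cast
    nlinarith

theorem sum_log_le_log_factorial {m : ℕ} (hm : 1 ≤ m) (k : ℕ) :
    ∑ j ∈ Finset.range k, Real.log ((j : ℝ) + m) ≤ Real.log (k + m).factorial := by
  induction k with
  | zero =>
    have : (1 : ℝ) ≤ m.factorial := by exact_mod_cast m.factorial_pos
    simpa using Real.log_nonneg this
  | succ k ih =>
    have hm0 : (1 : ℝ) ≤ m := by exact_mod_cast hm
    have e : (k + 1 + m).factorial = (k + m + 1) * (k + m).factorial := by
      rw [← Nat.factorial_succ]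
      congr 1
      ring
    rw [Finset.sum_range_succ, e, Nat.cast_mul, Real.log_mul (by positivity) (by positivity)]
    have : Real.log ((k : ℝ) + m) ≤ Real.log ((k + m + 1 : ℕ) : ℝ) := by
      refine Real.log_le_log (by positivity) ?_
      push_cast
      linarith
    linarith

/-- All but finitely many zeros of the Mittag-Leffler function are real. -/
theorem finite_nonreal_zeros_mittagLeffler {α β : ℝ} (hα : 2 < α) (hβ : 3 ≤ β) :
    {z : ℂ | mittagLeffler α β z = 0 ∧ z.im ≠ 0}.Finite := by
  classical
  by_contra hinf
  have hα0 : 0 < α := by linarith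
  have hπ := Real.pi_pos
  obtain ⟨C, hC⟩ := circleAverage_log_norm_mittagLeffler_le hα hβ
  obtain ⟨m, r, hrm, hr⟩ := exists_real_zeros_mittagLeffler hα hβ
  set σ := Real.sin (Real.pi / α) with hσ
  have hσ0 : 0 < σ := Real.sin_pos_of_pos_of_lt_pi (by positivity) (by
    rw [div_lt_iff₀ hα0]; nlinarith)
  have hm : 1 ≤ m := by
    by_contra h
    obtain rfl : m = 0 := by omega
    have h1 := (hr 0).1
    have h2 := (hr 0).2.2
    simp only [Nat.cast_zero, add_zero, mul_zero, zero_div, Real.zero_rpow hα0.ne'] at h2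
    linarith
  -- The real zeros fall short of αn by (m + 1) α log n up to a constant. With m + 2 nonreal zeros
  -- the Jensen sum exceeds αn by α log n, up to a constant.
  obtain ⟨Q, hQ, hQc⟩ := Set.Infinite.exists_subset_card_eq hinf (m + 2)
  have hE0 := mittagLeffler_complex_zero_ne α (by linarith : 0 < β)
  have hQ0 : ∀ u ∈ Q, 0 < ‖u‖ := fun u hu => norm_pos_iff.2 fun h => (hQ hu).2 (by simp [h])
  set ℓ : ℕ → ℝ := fun n => Real.pi * n / σ with hℓ
  have hbound : ∀ᶠ n : ℕ in atTop, α * Real.log n ≤ C + α - (m + 2) * α * Real.log (Real.pi / σ) +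
      ∑ u ∈ Q, Real.log ‖u‖ - Real.log ‖mittagLeffler α β (0 : ℂ)‖ := by
    have htop : Tendsto (fun n : ℕ => ℓ n ^ α) atTop atTop := by
      refine (tendsto_rpow_atTop hα0).comp (Tendsto.atTop_div_const hσ0 ?_)
      exact tendsto_natCast_atTop_atTop.const_mul_atTop hπ
    filter_upwards [htop.eventually_ge_atTop (∑ u ∈ Q, ‖u‖), eventually_ge_atTop m,
      eventually_ge_atTop 1] with n hnQ hnm hn1
    have hn0 : (0 : ℝ) < n := by exact_mod_cast hn1
    -- At this radius the bound on the circle mean is C + αn, and r j ≤ R for all j < n - m.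
    set R := ℓ n ^ α with hR
    have hℓ0 : 0 < ℓ n := by positivity
    have hR0 : 0 < R := by positivity
    have hlogR : Real.log R = α * (Real.log n + Real.log (Real.pi / σ)) := by
      rw [hR, Real.log_rpow hℓ0, ← Real.log_mul hn0.ne' (by positivity)]
      congr 2
      simp only [hℓ]
      ring
    have hinj : Function.Injective fun j => (-(r j) : ℂ) := fun i j hij => by
      have : r i = r j := by simpa using hij
      exact hrm.injective this
    set T := (Finset.range (n - m)).image fun j => (-(r j) : ℂ) with hT
    have hdisj : Disjoint T Q := by
      rw [Finset.disjoint_left]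
      intro u hu huQ
      obtain ⟨j, -, rfl⟩ := Finset.mem_image.1 hu
      exact (hQ huQ).2 (by simp)
    have hTn : ∀ j, ‖(-(r j) : ℂ)‖ = r j := fun j => by
      rw [norm_neg, norm_real, Real.norm_of_nonneg (hr j).1.le]
    have hjen := sum_log_div_norm_add_le_circleAverage (mittagLeffler_differentiable hα0 β) hE0 hR0
      (T ∪ Q) fun u hu => by
        rcases Finset.mem_union.1 hu with hu | hu
        · obtain ⟨j, hj, rfl⟩ := Finset.mem_image.1 hu
          refine ⟨?_, ?_⟩
          · have := mittagLeffler_ofReal α β (-r j)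
            rw [(hr j).2.1] at this
            simpa using this
          · rw [hTn]
            refine (hr j).2.2.trans (Real.rpow_le_rpow (by positivity) ?_ hα0.le)
            have : ((j + m : ℕ) : ℝ) ≤ n := by
              exact_mod_cast (by have := Finset.mem_range.1 hj; omega : j + m ≤ n)
            push_cast at this
            simp only [hℓ]
            gcongr
        · exact ⟨(hQ hu).1, (Finset.single_le_sum (fun u _ => norm_nonneg u) hu).trans hnQ⟩
    rw [Finset.sum_union hdisj, hT, Finset.sum_image fun i _ j _ h => hinj h] at hjen
    have havg := hC R hR0
    have hRα : R ^ (1 / α) * (α * σ / Real.pi) = α * n := by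
      rw [hR, ← Real.rpow_mul hℓ0.le, mul_one_div_cancel hα0.ne', Real.rpow_one]
      simp only [hℓ]
      field_simp
    rw [hRα] at havg
    have hsumQ : ∑ u ∈ Q, Real.log (R / ‖u‖) =
        (m + 2) * Real.log R - ∑ u ∈ Q, Real.log ‖u‖ := by
      rw [Finset.sum_congr rfl fun u hu => Real.log_div hR0.ne' (hQ0 u hu).ne',
        Finset.sum_sub_distrib, Finset.sum_const, hQc]
      simp
    have hsumT : α * (n - 1 - (m + 1) * Real.log n) ≤
        ∑ j ∈ Finset.range (n - m), Real.log (R / ‖(-(r j) : ℂ)‖) := by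
      have h1 : ∀ j ∈ Finset.range (n - m), α * (Real.log n - Real.log ((j : ℝ) + m)) ≤
          Real.log (R / ‖(-(r j) : ℂ)‖) := by
        intro j _
        have hm0 : (0 : ℝ) < m := by exact_mod_cast hm
        have hjm : (0 : ℝ) < (j : ℝ) + m := by positivity
        have h2 := Real.log_le_log (hr j).1 (hr j).2.2
        rw [Real.log_rpow (by positivity), mul_div_right_comm, mul_comm (Real.pi / σ),
          Real.log_mul hjm.ne' (by positivity)] at h2
        rw [hTn, Real.log_div hR0.ne' (hr j).1.ne', hlogR]
        linarith
      refine le_trans ?_ (Finset.sum_le_sum h1)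
      rw [← Finset.mul_sum, Finset.sum_sub_distrib, Finset.sum_const, Finset.card_range,
        nsmul_eq_mul, Nat.cast_sub hnm]
      have h3 := sum_log_le_log_factorial hm (n - m)
      rw [Nat.sub_add_cancel hnm] at h3
      have h4 := log_factorial_le hn1
      exact mul_le_mul_of_nonneg_left (by linarith) hα0.le
    rw [hsumQ, hlogR] at hjen
    linarith
  have htop : Tendsto (fun n : ℕ => α * Real.log n) atTop atTop :=
    (Real.tendsto_log_atTop.comp tendsto_natCast_atTop_atTop).const_mul_atTop hα0
  obtain ⟨n, h1, h2⟩ := (hbound.and (htop.eventually_gt_atTop _)).exists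
  exact absurd h1 (not_le.2 h2)

/-! ### The inequality outside a disk -/

theorem mainTheorem7 (α β : ℝ) (hα : 2 < α) (hβ : 2 * α - 1 < β) :
    ∃ K : Set ℂ, IsCompact K ∧
      ∀ z : ℂ, z ∉ K → mittagLeffler α β z.re ≤ ‖mittagLeffler α β z‖ := by
  have hα0 : 0 < α := by linarith
  have hβ3 : 3 ≤ β := by linarith
  obtain ⟨R₀, hR₀⟩ := (finite_nonreal_zeros_mittagLeffler hα hβ3).isBounded.exists_norm_le
  -- Outside this disk |z| ≥ 3|u| for every nonreal zero u.
  refine ⟨closedBall 0 (3 * R₀), isCompact_closedBall _ _, fun z hz => ?_⟩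
  rw [mem_closedBall_zero_iff, not_le] at hz
  set M : ℝ → ℝ := fun R => Real.exp 1 * Real.exp (|R| ^ (1 / α)) with hM
  have hfM : ∀ z : ℂ, ‖mittagLeffler α β z‖ ≤ M ‖z‖ := by
    intro z
    have h1 := mittagLeffler_rpow_le (by linarith : 1 ≤ α) hβ3
      (w := ‖z‖ ^ (1 / α)) (by positivity)
    rw [← Real.rpow_mul (norm_nonneg z), one_div_mul_cancel hα0.ne', Real.rpow_one] at h1
    simp only [hM, abs_norm]
    exact (norm_mittagLeffler_le hα0 (by linarith) z).trans h1
  have hM0 : ∀ R, ‖mittagLeffler α β (0 : ℂ)‖ ≤ M R := by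
    intro R
    refine (hfM 0).trans ?_
    simp only [hM, norm_zero, abs_zero]
    gcongr
    exact abs_nonneg R
  -- Order less than one: log M(3R) = 1 + (3R)^(1/α) = o(R) because α > 1.
  have hMo : Tendsto (fun R => Real.log (M (3 * R)) / R) atTop (𝓝 0) := by
    have h1 : Tendsto (fun R : ℝ => 1 / R + 3 ^ (1 / α) * R ^ (-(1 - 1 / α))) atTop
        (𝓝 (0 + 3 ^ (1 / α) * 0)) := by
      refine (tendsto_const_nhds.div_atTop tendsto_id).add
        ((tendsto_rpow_neg_atTop ?_).const_mul _)
      rw [sub_pos, div_lt_one hα0]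
      linarith
    rw [mul_zero, add_zero] at h1
    refine h1.congr' ?_
    filter_upwards [eventually_gt_atTop 0] with R hR
    simp only [hM]
    rw [Real.log_mul (Real.exp_pos _).ne' (Real.exp_pos _).ne', Real.log_exp, Real.log_exp,
      abs_of_pos (by positivity), Real.mul_rpow (by norm_num) hR.le, neg_sub,
      Real.rpow_sub_one hR.ne']
    ring
  have key := sq_norm_le_of_forall_zero (mittagLeffler_differentiable hα0 β)
    (mittagLeffler_complex_zero_ne α (by linarith)) hM0 hfM hMo (x := (z.re : ℂ)) (z := z)
    (w := (starRingEnd ℂ) z) fun u hu => sq_norm_re_sub_le (by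
      by_cases him : u.im = 0
      · exact Or.inl him
      · have := hR₀ u ⟨hu, him⟩
        exact Or.inr (by linarith))
  rw [mittagLeffler_conj, RCLike.norm_conj, ← sq, mittagLeffler_ofReal, norm_real] at key
  exact (Real.le_norm_self _).trans (le_of_sq_le_sq key (norm_nonneg _))
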